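/- **Notation.** For $a\in\mathbb C$, $n\in\mathbb N_0$, let $(a)_n=a(a+1)\cdots(a+n-1)$, and let $(a_1,\dots,a_p)_n=\prod_i (a_i)_n$; an empty list of parameters, written $-$, contributes the factor $1$. ${}_pF_q\left[{a_1,\dots,a_p\atop b_1,\dots,b_q}\Big|z\right]=\sum_{r\ge0}\frac{(a_1,\dots,a_p)_r}{(b_1,\dots,b_q)_r}\frac{z^r}{r!}$ is the generalized hypergeometric function. The Kampé de Fériet functions are $$F_{1:1;1}^{1:1;1}\left[{d:a;b\atop e:a';b'}\Big|\,{x\atop y}\right]=\sum_{r,s\ge0}\frac{(d)_{r+s}(a)_r(b)_s}{(e)_{r+s}(a')_r(b')_s}\frac{x^r}{r!}\frac{y^s}{s!},$$ and $F_{0:1;1}^{1:1;1}\left[{d:a;b\atop -:a';b'}\Big|{x\atop y}\right]$ is the same series without the factor $(e)_{r+s}$. The cases of Srivastava's triple function that occur are $$F^{(3)}\left[{d::-;-;-:-;a;b\atop e::-;-;-:-;a';b'}\Big|\,u,x,y\right]=\sum_{p,r,s\ge0}\frac{(d)_{p+r+s}(a)_r(b)_s}{(e)_{p+r+s}(a')_r(b')_s}\frac{u^p}{p!}\frac{x^r}{r!}\frac{y^s}{s!},$$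 and, with $-$ in place of $e$, the same series without the factor $(e)_{p+r+s}$. The cases of Srivastava's $\mathcal S$-function that occur are $$\mathcal S_{1:0;3}^{1:0;2}\left[{[d:1,2]:-;a_1,a_2\atop [e:1,2]:-;b_1,b_2,b_3}\Big|\,{x\atop y}\right]=\sum_{p,q\ge0}\frac{(d)_{p+2q}(a_1,a_2)_q}{(e)_{p+2q}(b_1,b_2,b_3)_q}\frac{x^p}{p!}\frac{y^q}{q!},$$ and $\mathcal S_{0:0;3}^{1:0;2}$ is the same series without the parameter $e$. **Theorem.** Let $m,n\in\mathbb N_0$, let $d,e\in\mathbb C$ with $\Re(e)>\Re(d)>0$, and let $\alpha,\beta\in\mathbb C$ be such that no denominator in the formulas below vanishes, that is: none of $2\alpha-m$, $2\beta-n$, $\alpha-m+\frac12$, $\beta-n+\frac12$, $\alpha+\beta-m-n$ lies in $\{0,-1,-2,\dots\}$; $\alpha\ne m+\frac12$ if $m\ge1$; and $\beta\ne n+\frac12$ if $n\ge1$. For $0\le j\le m$, $0\le k\le n$ and $x\in\mathbb C$ put $g_{jk}=\alpha+\beta+j+k-m-n$ and $$C_{jk}(x)=\frac{(-1)^{j+k}(-m)_j(-n)_k(2\alpha-2m-1)_j(2\beta-2n-1)_k\,x^{j+k}}{(2\alpha-m)_j(2\beta-n)_k(\alpha-m-\frac12)_j(\beta-n-\frac12)_k\,2^{2j+2k}\,j!\,k!}.$$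 All series in the following identities converge absolutely for the stated $x$, and: 1. For all $x\in\mathbb C$, $$F_{1:1;1}^{1:1;1}\left[{d:\alpha;\beta\atop e:2\alpha-m;2\beta-n}\Big|{x\atop x}\right]=\sum_{j=0}^m\sum_{k=0}^n\frac{(d)_{j+k}}{(e)_{j+k}}C_{jk}(x)\;\mathcal S_{1:0;3}^{1:0;2}\left[{[d+j+k:1,2]:-;\ \frac{g_{jk}}2,\frac{g_{jk}+1}2\atop [e+j+k:1,2]:-;\ \alpha+j-m+\frac12,\beta+k-n+\frac12,g_{jk}}\Big|{x\atop \frac14x^2}\right].$$ 2. For all $x\in\mathbb C$, $$F_{1:1;1}^{1:1;1}\left[{d:\alpha;\beta-n\atop e:2\alpha-m;2\beta-n}\Big|{x\atop -x}\right]=F^{(3)}\left[{d::-;-;-:-;\alpha;\beta\atop e::-;-;-:-;2\alpha-m;2\beta-n}\Big|-x,x,x\right]$$ $$=\sum_{j=0}^m\sum_{k=0}^n\frac{(d)_{j+k}}{(e)_{j+k}}C_{jk}(x)\;{}_4F_5\left[{\frac{g_{jk}}2,\frac{g_{jk}+1}2,\frac{d+j+k}2,\frac{d+j+k+1}2\atop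 \alpha+j-m+\frac12,\beta+k-n+\frac12,g_{jk},\frac{e+j+k}2,\frac{e+j+k+1}2}\Big|\frac14x^2\right].$$ 3. For all $x\in\mathbb C$ with $|x|<\frac12$, $$F_{0:1;1}^{1:1;1}\left[{d:\alpha;\beta\atop -:2\alpha-m;2\beta-n}\Big|{x\atop x}\right]=\sum_{j=0}^m\sum_{k=0}^n(d)_{j+k}\,C_{jk}(x)\;\mathcal S_{0:0;3}^{1:0;2}\left[{[d+j+k:1,2]:-;\ \frac{g_{jk}}2,\frac{g_{jk}+1}2\atop -:-;\ \alpha+j-m+\frac12,\beta+k-n+\frac12,g_{jk}}\Big|{x\atop \frac14x^2}\right].$$ 4. For all $x\in\mathbb C$ with $|x|<\frac12$, $$F_{0:1;1}^{1:1;1}\left[{d:\alpha;\beta-n\atop -:2\alpha-m;2\beta-n}\Big|{x\atop -x}\right]=\sum_{j=0}^m\sum_{k=0}^n(d)_{j+k}\,C_{jk}(x)\;{}_4F_3\left[{\frac{g_{jk}}2,\frac{g_{jk}+1}2,\frac{d+j+k}2,\frac{d+j+k+1}2\atop \alpha+j-m+\frac12,\beta+k-n+\frac12,g_{jk}}\Big|x^2\right],$$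 and if moreover $|x|<\frac13$, both sides are equal to $$F^{(3)}\left[{d::-;-;-:-;\alpha;\beta\atop -::-;-;-:-;2\alpha-m;2\beta-n}\Big|-x,x,x\right].$$ -/

import Mathlib

/-- The rising factorial (Pochhammer symbol) `(a)_n = a (a + 1) ⋯ (a + n - 1)`. -/
noncomputable def poch (a : ℂ) (n : ℕ) : ℂ := (ascPochhammer ℂ n).eval a

/-- The product of the Pochhammer symbols `(a)_n` over all entries `a` of a list of parameters;
an empty list (written `-` in the classical notation) gives `1`. -/
noncomputable def pochProd (as : List ℂ) (n : ℕ) : ℂ := (as.map fun a => poch a n).prod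

/-- The `q`-th term of the generalized hypergeometric series `ₚF_q[as; bs | z]`. -/
noncomputable def hypTerm (as bs : List ℂ) (z : ℂ) (q : ℕ) : ℂ :=
  pochProd as q / pochProd bs q * (z ^ q / (q.factorial : ℂ))

/-- The generalized hypergeometric function `ₚF_q[as; bs | z]`. -/
noncomputable def hyp (as bs : List ℂ) (z : ℂ) : ℂ := ∑' q : ℕ, hypTerm as bs z q

/-- The `(r, s)`-th term of the Kampé de Fériet series
`F[a : b ; b' / c : d ; d' | x, y]`. -/
noncomputable def kampeTerm (a b b' c d d' : List ℂ) (x y : ℂ) (i : ℕ × ℕ) : ℂ :=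
  (pochProd a (i.1 + i.2) * pochProd b i.1 * pochProd b' i.2) /
    (pochProd c (i.1 + i.2) * pochProd d i.1 * pochProd d' i.2) *
    (x ^ i.1 / (i.1.factorial : ℂ)) * (y ^ i.2 / (i.2.factorial : ℂ))

/-- The Kampé de Fériet function `F[a : b ; b' / c : d ; d' | x, y]`: upper parameters
`a : b ; b'`, lower parameters `c : d ; d'`. -/
noncomputable def kampe (a b b' c d d' : List ℂ) (x y : ℂ) : ℂ :=
  ∑' i : ℕ × ℕ, kampeTerm a b b' c d d' x y i

/-- The parameters of one line of Srivastava's function `F⁽³⁾`, in the classical order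
`a :: b ; b' ; b'' : c ; c' ; c''`. -/
structure TripleParams where
  a : List ℂ
  b : List ℂ
  b' : List ℂ
  b'' : List ℂ
  c : List ℂ
  c' : List ℂ
  c'' : List ℂ

/-- The product of Pochhammer symbols which one line of parameters of `F⁽³⁾` contributes to the
term of index `(r, s, t)`. -/
noncomputable def TripleParams.prod (P : TripleParams) (r s t : ℕ) : ℂ :=
  pochProd P.a (r + s + t) *
    (pochProd P.b (r + s) * pochProd P.b' (s + t) * pochProd P.b'' (t + r)) *
    (pochProd P.c r * pochProd P.c' s * pochProd P.c'' t)

/-- The `(r, s, t)`-th term of Srivastava's triple hypergeometric series `F⁽³⁾`. -/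
noncomputable def tripleTerm (U L : TripleParams) (x y z : ℂ) (i : ℕ × ℕ × ℕ) : ℂ :=
  U.prod i.1 i.2.1 i.2.2 / L.prod i.1 i.2.1 i.2.2 *
    (x ^ i.1 / (i.1.factorial : ℂ)) * (y ^ i.2.1 / (i.2.1.factorial : ℂ)) *
    (z ^ i.2.2 / (i.2.2.factorial : ℂ))

/-- Srivastava's general triple hypergeometric function `F⁽³⁾[U / L | x, y, z]`, with upper
parameters `U` and lower parameters `L`. -/
noncomputable def triple (U L : TripleParams) (x y z : ℂ) : ℂ :=
  ∑' i : ℕ × ℕ × ℕ, tripleTerm U L x y z i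

/-- The product of `(a)_{θ p + φ q}` over a list of joint parameters `[a : θ, φ]`. -/
noncomputable def jointProd (as : List (ℂ × ℕ × ℕ)) (p q : ℕ) : ℂ :=
  (as.map fun a => poch a.1 (a.2.1 * p + a.2.2 * q)).prod

/-- The product of `(b)_{ψ p}` over a list of separate parameters `[b : ψ]`. -/
noncomputable def separateProd (bs : List (ℂ × ℕ)) (p : ℕ) : ℂ :=
  (bs.map fun b => poch b.1 (b.2 * p)).prod

/-- The `(p, q)`-th term of the Srivastava–Daoust double series
`S[a : b ; b' / c : d ; d' | x, y]`, with natural numbers as the weights. -/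
noncomputable def srivTerm (a : List (ℂ × ℕ × ℕ)) (b b' : List (ℂ × ℕ))
    (c : List (ℂ × ℕ × ℕ)) (d d' : List (ℂ × ℕ)) (x y : ℂ) (i : ℕ × ℕ) : ℂ :=
  (jointProd a i.1 i.2 * separateProd b i.1 * separateProd b' i.2) /
    (jointProd c i.1 i.2 * separateProd d i.1 * separateProd d' i.2) *
    (x ^ i.1 / (i.1.factorial : ℂ)) * (y ^ i.2 / (i.2.factorial : ℂ))

/-- The Srivastava–Daoust `S`-function `S[a : b ; b' / c : d ; d' | x, y]` (normalized by
Pochhammer symbols, so that its value at the origin is `1`). A separate parameter which is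
written without a weight has weight `1`. -/
noncomputable def sriv (a : List (ℂ × ℕ × ℕ)) (b b' : List (ℂ × ℕ))
    (c : List (ℂ × ℕ × ℕ)) (d d' : List (ℂ × ℕ)) (x y : ℂ) : ℂ :=
  ∑' i : ℕ × ℕ, srivTerm a b b' c d d' x y i

open Finset PowerSeries

/-! ### Pochhammer symbols -/

/-! Every series in the theorem is the value of a linear functional L_c : ∑ f_n X^n ↦ ∑ c_n f_n on a
product of formal power series, where c_n = (d)_n x^n / (e)_n, or (d)_n x^n when e is absent
(`weight`). A factor depending only on r + s passes through the Cauchy product, so the double series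
with arguments x, x is L_c(F G), with F = ₁F₁[α; 2α - m | X] and G = ₁F₁[β; 2β - n | X]. This turns
the theorem into identities between formal power series, plus absolute convergence.

The identity that matters expands exp(-X) F G (`expSeries_mul_kummerSeries_mul_kummerSeries`).
Kummer's second transformation says that exp(-X/2) ₁F₁[α; 2α | X] is a single ₀F₁ in X²/16. For 2α -
m it becomes a sum of m + 1 terms X^j ₀F₁[-; α + j - m + 1/2 | X²/16]
(`expSeries_mul_kummerSeries`). Both sides solve the same second-order equation, whose power series
solutions are fixed by their constant term; on the right the operator telescopes and the sum stops
because (-m)_{m+1} = 0. Products of two ₀F₁ are then ₂F₃ series in X² (`besselAux_mul`), by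
Chu–Vandermonde.

Applying L_c finishes. A factor X^{j+k} shifts d and e by j + k (`weight_add`), and a series in X²
samples c at even indices. For equal arguments F G = exp(X) · exp(-X) F G, and the extra exponential
gives the double series with weights 1, 2. For opposite arguments Kummer's first transformation
absorbs exp(-X) into G, leaving a single series; keeping exp(-X) as a third factor gives the triple
series.

Convergence: if c_n = O(ρ^n n!) and the factors have coefficients O(σ^n / n!), then N factors
converge absolutely when Nρσ < 1. Here σ can be any number above 1. With e present ρ is arbitrarily
small; without e any ρ > |x| works, whence the radii 1/2 and 1/3. -/

@[simp] theorem poch_zero (a : ℂ) : poch a 0 = 1 := by simp [poch]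

theorem poch_succ (a : ℂ) (n : ℕ) : poch a (n + 1) = poch a n * (a + n) := by
  simp [poch, ascPochhammer_succ_eval]

theorem poch_add (a : ℂ) (n k : ℕ) : poch a (n + k) = poch a n * poch (a + n) k := by
  induction k with
  | zero => simp
  | succ k ih => rw [← add_assoc, poch_succ, ih, poch_succ]; push_cast; ring

theorem poch_ne_zero {a : ℂ} (h : ∀ i : ℕ, a ≠ -(i : ℂ)) (n : ℕ) : poch a n ≠ 0 := by
  induction n with
  | zero => simp
  | succ n ih =>
    rw [poch_succ]
    exact mul_ne_zero ih fun h0 => h n (eq_neg_of_add_eq_zero_left h0)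

theorem poch_one (n : ℕ) : poch 1 n = n.factorial := by
  induction n with
  | zero => simp
  | succ n ih => rw [poch_succ, ih, Nat.factorial_succ]; push_cast; ring

theorem poch_neg_natCast (m : ℕ) : poch (-m) (m + 1) = 0 := by
  rw [poch_succ]; simp

/-- The duplication formula. -/
theorem poch_two_mul (a : ℂ) (q : ℕ) :
    poch a (2 * q) = 4 ^ q * (poch (a / 2) q * poch ((a + 1) / 2) q) := by
  induction q with
  | zero => simp
  | succ q ih =>
    rw [mul_add, mul_one, show 2 * q + 2 = 2 * q + 1 + 1 from rfl, poch_succ, poch_succ, ih,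
      poch_succ, poch_succ]
    push_cast
    ring

theorem poch_succ_left (a : ℂ) (n : ℕ) : poch a (n + 1) = a * poch (a + 1) n := by
  rw [add_comm, poch_add, poch_succ]; simp

/-- Splitting (b)_n = (b)_{n-i} (b+n-i)_i and reflecting the last factor turns 1/(b)_{n-i} into
±(1-b-n)_i / (b)_n. This brings the Cauchy products below into Chu–Vandermonde form. -/
theorem poch_reflect (a : ℂ) (n : ℕ) : poch (1 - a - n) n = (-1) ^ n * poch a n := by
  induction n generalizing a with
  | zero => simp
  | succ n ih =>
    rw [poch_succ, poch_succ_left, pow_succ]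
    have := ih (a + 1)
    rw [show 1 - (a + 1) - (n : ℂ) = 1 - a - ((n + 1 : ℕ) : ℂ) by push_cast; ring] at this
    rw [this]; push_cast; ring

/-- The Chu–Vandermonde identity for rising factorials. -/
theorem sum_antidiagonal_choose_mul_poch (a b : ℂ) (n : ℕ) :
    ∑ i ∈ antidiagonal n, (n.choose i.1 : ℂ) * (poch a i.1 * poch b i.2) = poch (a + b) n := by
  induction n with
  | zero => simp
  | succ n ih =>
    -- Pascal's rule splits the sum in two; termwise the new factors add up to (a + i) + (b + j) = a
    -- + b + n.
    rw [Finset.sum_antidiagonal_choose_succ_mul (fun i j => poch a i * poch b j), poch_succ, ← ih,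
      Finset.sum_mul, ← Finset.sum_add_distrib]
    refine Finset.sum_congr rfl fun i hi => ?_
    rw [HasAntidiagonal.mem_antidiagonal] at hi
    have : (n.choose i.2 : ℂ) = n.choose i.1 := by
      rw [Nat.choose_symm_of_eq_add (by omega : n = i.2 + i.1)]
    rw [this, poch_succ, poch_succ, ← hi]
    push_cast
    ring

theorem choose_div_factorial {n : ℕ} {i : ℕ × ℕ} (hi : i ∈ antidiagonal n) :
    (n.choose i.1 : ℂ) / n.factorial = 1 / (i.1.factorial * i.2.factorial) := by
  rw [HasAntidiagonal.mem_antidiagonal] at hi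
  subst hi
  have h := Nat.add_choose_mul_factorial_mul_factorial i.1 i.2
  have h1 : (i.1.factorial : ℂ) ≠ 0 := by exact_mod_cast i.1.factorial_ne_zero
  have h2 : (i.2.factorial : ℂ) ≠ 0 := by exact_mod_cast i.2.factorial_ne_zero
  have h3 : ((i.1 + i.2).factorial : ℂ) ≠ 0 := by exact_mod_cast (i.1 + i.2).factorial_ne_zero
  have h' : (((i.1 + i.2).choose i.1 * i.1.factorial * i.2.factorial : ℕ) : ℂ)
    = (i.1 + i.2).factorial := by rw [Nat.choose_symm_add, h]
  push_cast at h'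
  field_simp
  linear_combination h'

/-! ### The formal power series of the confluent hypergeometric functions -/

/-- The formal power series of `₁F₁[a; b | X]`. -/
noncomputable def kummerSeries (a b : ℂ) : ℂ⟦X⟧ :=
  PowerSeries.mk fun r => poch a r / (poch b r * r.factorial)

/-- The formal power series of `₀F₁[-; ν | X / 16]`. -/
noncomputable def besselAux (ν : ℂ) : ℂ⟦X⟧ :=
  PowerSeries.mk fun q => 1 / (poch ν q * q.factorial * 16 ^ q)

/-- The formal power series of `₀F₁[-; ν | X ^ 2 / 16]`. -/
noncomputable def besselSeries (ν : ℂ) : ℂ⟦X⟧ := expand 2 two_ne_zero (besselAux ν)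

/-- The formal power series of `exp (c X)`. -/
noncomputable def expSeries (c : ℂ) : ℂ⟦X⟧ := rescale c (PowerSeries.exp ℂ)

theorem coeff_expSeries (c : ℂ) (n : ℕ) : coeff n (expSeries c) = c ^ n / n.factorial := by
  simp [expSeries, coeff_rescale, coeff_exp, div_eq_mul_inv]

theorem expSeries_add (c c' : ℂ) : expSeries (c + c') = expSeries c * expSeries c' :=
  (exp_mul_exp_eq_exp_add c c').symm

theorem expSeries_zero : expSeries 0 = 1 := by
  ext n
  rw [coeff_expSeries, coeff_one]
  cases n <;> simp

theorem derivative_expSeries (c : ℂ) : d⁄dX ℂ (expSeries c) = C c * expSeries c := by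
  ext n
  rw [coeff_derivative, coeff_C_mul, coeff_expSeries, coeff_expSeries, Nat.factorial_succ]
  have : (n.factorial : ℂ) ≠ 0 := by exact_mod_cast n.factorial_ne_zero
  have : (n + 1 : ℂ) ≠ 0 := by exact_mod_cast n.succ_ne_zero
  push_cast
  field_simp
  ring

/-- Coefficientwise this is the ratio (n+1)(b+n) u_{n+1} = (a+n) u_n of consecutive terms. -/
theorem kummerSeries_ode (a b : ℂ) (hb : ∀ i : ℕ, b ≠ -(i : ℂ)) :
    X * d⁄dX ℂ (d⁄dX ℂ (kummerSeries a b)) + (C b - X) * d⁄dX ℂ (kummerSeries a b) =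
      C a * kummerSeries a b := by
  have key : ∀ n : ℕ, (n + 1) * (b + n) * coeff (n + 1) (kummerSeries a b) =
      (a + n) * coeff n (kummerSeries a b) := by
    intro n
    have h1 : b + n ≠ 0 := fun h0 => hb n (eq_neg_of_add_eq_zero_left h0)
    have h2 := poch_ne_zero hb n
    have : (n.factorial : ℂ) ≠ 0 := by exact_mod_cast n.factorial_ne_zero
    have : (n + 1 : ℂ) ≠ 0 := by exact_mod_cast n.succ_ne_zero
    simp only [kummerSeries, coeff_mk, poch_succ, Nat.factorial_succ]
    push_cast
    field_simp
  ext n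
  have := key n
  cases n with
  | zero =>
    simp only [map_add, sub_mul, map_sub, coeff_zero_X_mul, coeff_C_mul, coeff_derivative]
    push_cast at this ⊢
    linear_combination this
  | succ n =>
    simp only [map_add, sub_mul, map_sub, coeff_succ_X_mul, coeff_C_mul, coeff_derivative] at this ⊢
    push_cast at this ⊢
    linear_combination this

/-- Kummer's first transformation. -/
theorem expSeries_neg_one_mul_kummerSeries (a b : ℂ) (hb : ∀ i : ℕ, b ≠ -(i : ℂ)) :
    expSeries (-1) * kummerSeries a b = rescale (-1) (kummerSeries (b - a) b) := by
  ext n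
  have h := sum_antidiagonal_choose_mul_poch (1 - b - n) a n
  rw [show 1 - b - n + a = 1 - (b - a) - (n : ℂ) by ring, poch_reflect] at h
  rw [coeff_mul, coeff_rescale, kummerSeries, kummerSeries, coeff_mk]
  rw [show (-1) ^ n * (poch (b - a) n / (poch b n * n.factorial)) =
      ((-1) ^ n * poch (b - a) n) * (1 / (poch b n * n.factorial)) by ring, ← h, Finset.sum_mul]
  refine Finset.sum_congr rfl fun i hi => ?_
  have hc := choose_div_factorial hi
  rw [HasAntidiagonal.mem_antidiagonal] at hi
  have hr := poch_reflect (b + i.2) i.1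
  rw [show 1 - (b + i.2) - (i.1 : ℂ) = 1 - b - n by rw [← hi]; push_cast; ring] at hr
  have hp : poch b n = poch b i.2 * poch (b + i.2) i.1 := by rw [← hi, add_comm, poch_add]
  have h2 := poch_ne_zero hb n
  have h3 := poch_ne_zero hb i.2
  have h4 : poch (b + i.2) i.1 ≠ 0 := fun h0 => h2 (by rw [hp, h0, mul_zero])
  rw [coeff_expSeries, coeff_mk, hr, hp]
  calc _ = (-1) ^ i.1 * poch a i.2 / poch b i.2 * (1 / (i.1.factorial * i.2.factorial)) := by
        field_simp
    _ = _ := by rw [← hc]; field_simp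

/-- The product formula of two series `₀F₁`. -/
theorem besselAux_mul (a b : ℂ) (ha : ∀ i : ℕ, a ≠ -(i : ℂ)) (hb : ∀ i : ℕ, b ≠ -(i : ℂ))
    (hab : ∀ i : ℕ, a + b - 1 ≠ -(i : ℂ)) :
    besselAux a * besselAux b = PowerSeries.mk fun q =>
      poch ((a + b - 1) / 2) q * poch ((a + b - 1 + 1) / 2) q /
        (poch a q * poch b q * poch (a + b - 1) q * 4 ^ q * q.factorial) := by
  ext n
  have h := sum_antidiagonal_choose_mul_poch (1 - b - n) (1 - a - n) n
  -- With g = a + b - 1, Chu–Vandermonde produces (g+n)_n = (g)_{2n} / (g)_n, and duplication of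
  -- (g)_{2n} gives the two half-parameters in the numerator.
  rw [show 1 - b - n + (1 - a - n) = 1 - (a + b - 1 + n) - (n : ℂ) by ring, poch_reflect] at h
  have hg := poch_two_mul (a + b - 1) n
  have hg2 := poch_add (a + b - 1) n n
  rw [← two_mul, hg] at hg2
  have h0 := poch_ne_zero hab n
  have h1 := poch_ne_zero ha n
  have h2 := poch_ne_zero hb n
  have hf : (n.factorial : ℂ) ≠ 0 := by exact_mod_cast n.factorial_ne_zero
  rw [coeff_mul, coeff_mk]
  have e1 : poch ((a + b - 1) / 2) n * poch ((a + b - 1 + 1) / 2) n /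
        (poch a n * poch b n * poch (a + b - 1) n * 4 ^ n * n.factorial) =
      ((-1) ^ n * poch (a + b - 1 + n) n) *
        ((-1) ^ n / (poch a n * poch b n * 16 ^ n * n.factorial)) := by
    have e16 : (16 : ℂ) ^ n = 4 ^ n * 4 ^ n := by rw [← mul_pow]; norm_num
    have e1 : ((-1 : ℂ) ^ n) ^ 2 = 1 := by rw [← pow_mul, mul_comm, pow_mul]; simp
    rw [e16]
    field_simp
    rw [e1]
    linear_combination hg2
  rw [e1, ← h, Finset.sum_mul]
  refine Finset.sum_congr rfl fun i hi => ?_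
  have hc := choose_div_factorial hi
  rw [HasAntidiagonal.mem_antidiagonal] at hi
  have hr := poch_reflect (a + i.1) i.2
  rw [show 1 - (a + i.1) - (i.2 : ℂ) = 1 - a - n by rw [← hi]; push_cast; ring] at hr
  have hr' := poch_reflect (b + i.2) i.1
  rw [show 1 - (b + i.2) - (i.1 : ℂ) = 1 - b - n by rw [← hi]; push_cast; ring] at hr'
  have hp : poch a n = poch a i.1 * poch (a + i.1) i.2 := by rw [← hi, poch_add]
  have hp' : poch b n = poch b i.2 * poch (b + i.2) i.1 := by rw [← hi, add_comm, poch_add]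
  have h4 : poch (a + i.1) i.2 ≠ 0 := fun h0 => h1 (by rw [hp, h0, mul_zero])
  have h4' : poch (b + i.2) i.1 ≠ 0 := fun h0 => h2 (by rw [hp', h0, mul_zero])
  have h5 := poch_ne_zero ha i.1
  have h6 := poch_ne_zero hb i.2
  have es : (-1 : ℂ) ^ n = (-1) ^ i.1 * (-1) ^ i.2 := by rw [← pow_add, hi]
  have e16 : (16 : ℂ) ^ n = 16 ^ i.1 * 16 ^ i.2 := by rw [← pow_add, hi]
  have q1 : ((-1 : ℂ) ^ i.1) ^ 2 = 1 := by rw [← pow_mul, mul_comm, pow_mul]; simp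
  have q2 : ((-1 : ℂ) ^ i.2) ^ 2 = 1 := by rw [← pow_mul, mul_comm, pow_mul]; simp
  rw [besselAux, besselAux, coeff_mk, coeff_mk, hr, hr', hp, hp', es, e16]
  calc _ = 1 / (poch a i.1 * poch b i.2 * 16 ^ i.1 * 16 ^ i.2) *
          (1 / (i.1.factorial * i.2.factorial)) := by
        field_simp
    _ = _ := by
      rw [← hc]
      field_simp
      rw [q1, q2]
      ring

/-- The three-term recurrence of Bessel functions. Together with the derivative formula it keeps the
images of the terms X^j ₀F₁[-; ν + j] under the differential operator in the span of such terms. -/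
theorem besselAux_contiguous (ν : ℂ) (hν : ∀ i : ℕ, ν ≠ -(i : ℂ)) :
    besselAux ν = besselAux (ν + 1) + C (1 / (16 * ν * (ν + 1))) * (X * besselAux (ν + 2)) := by
  have h0 : ν ≠ 0 := by simpa using hν 0
  have h1 : ν + 1 ≠ 0 := fun h => hν 1 (by push_cast; linear_combination h)
  ext n
  cases n with
  | zero => simp [besselAux]
  | succ n =>
    have h2 : ∀ k : ℕ, ν + k ≠ 0 := fun k h => hν k (eq_neg_of_add_eq_zero_left h)
    have h3 : poch (ν + 2) n ≠ 0 := poch_ne_zero (fun i h => hν (2 + i) (by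
      push_cast; linear_combination h)) n
    have hf : (n.factorial : ℂ) ≠ 0 := by exact_mod_cast n.factorial_ne_zero
    have hn : (n + 1 : ℂ) ≠ 0 := by exact_mod_cast n.succ_ne_zero
    have e1 : poch ν (n + 1) * (ν + n + 1) = ν * (ν + 1) * poch (ν + 2) n := by
      have := poch_succ ν (n + 1)
      rw [poch_succ_left, poch_succ_left, add_assoc ν 1 1, one_add_one_eq_two] at this
      push_cast at this
      linear_combination -this
    have e2 : poch (ν + 1) (n + 1) = (ν + 1) * poch (ν + 2) n := by
      rw [poch_succ_left, add_assoc ν 1 1, one_add_one_eq_two]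
    have h4 : ν + n + 1 ≠ 0 := by simpa [add_assoc] using h2 (n + 1)
    have e1' : poch ν (n + 1) = ν * (ν + 1) * poch (ν + 2) n / (ν + n + 1) := by
      rw [eq_div_iff h4, e1]
    simp only [map_add, coeff_C_mul, coeff_succ_X_mul, besselAux, coeff_mk, e2, e1',
      Nat.factorial_succ]
    push_cast
    field_simp
    ring

theorem derivative_besselAux (ν : ℂ) (hν : ∀ i : ℕ, ν ≠ -(i : ℂ)) :
    d⁄dX ℂ (besselAux ν) = C (1 / (16 * ν)) * besselAux (ν + 1) := by
  ext n
  have h0 : ν ≠ 0 := by simpa using hν 0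
  have h3 : poch (ν + 1) n ≠ 0 := poch_ne_zero (fun i h => hν (1 + i) (by
      push_cast; linear_combination h)) n
  have hf : (n.factorial : ℂ) ≠ 0 := by exact_mod_cast n.factorial_ne_zero
  have hn : (n + 1 : ℂ) ≠ 0 := by exact_mod_cast n.succ_ne_zero
  simp only [coeff_derivative, coeff_C_mul, besselAux, coeff_mk, poch_succ_left,
    Nat.factorial_succ]
  push_cast
  field_simp
  ring

theorem besselSeries_contiguous (ν : ℂ) (hν : ∀ i : ℕ, ν ≠ -(i : ℂ)) :
    besselSeries ν =
      besselSeries (ν + 1) + C (1 / (16 * ν * (ν + 1))) * (X ^ 2 * besselSeries (ν + 2)) := by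
  rw [besselSeries, besselAux_contiguous ν hν, map_add, map_mul, map_mul, expand_C, expand_X]
  rfl

theorem derivative_besselSeries (ν : ℂ) (hν : ∀ i : ℕ, ν ≠ -(i : ℂ)) :
    d⁄dX ℂ (besselSeries ν) = C (1 / (8 * ν)) * (X * besselSeries (ν + 1)) := by
  have h0 : ν ≠ 0 := by simpa using hν 0
  have hs : HasSubst (X ^ 2 : ℂ⟦X⟧) := HasSubst.X_pow (n := 2) two_ne_zero
  rw [besselSeries, expand_apply, derivative_subst hs, derivative_besselAux ν hν, ← expand_apply 2 two_ne_zero,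
    map_mul, expand_C, Derivation.leibniz_pow, derivative_X, besselSeries]
  have : (C (1 / (8 * ν)) : ℂ⟦X⟧) = 2 * C (1 / (16 * ν)) := by
    rw [show (2 : ℂ⟦X⟧) = C 2 from (map_ofNat C 2).symm, ← map_mul]; congr 1; field_simp; norm_num
  rw [this]
  simp
  ring

/-! ### Kummer's second transformation and its extension to `₁F₁[α; 2α - m]` -/

/-- The operator of the differential equation satisfied by `exp (-X / 2) ₁F₁[(b - m) / 2; b]`. -/
noncomputable def kummerOp (b m : ℂ) : ℂ⟦X⟧ →ₗ[ℂ] ℂ⟦X⟧ where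
  toFun w := X * d⁄dX ℂ (d⁄dX ℂ w) + C b * d⁄dX ℂ w - C (m / 2) * w - C (1 / 4) * (X * w)
  map_add' v w := by simp only [map_add]; ring
  map_smul' c w := by
    simp only [smul_eq_C_mul, Derivation.leibniz, derivative_C, smul_eq_mul, mul_zero, add_zero,
      RingHom.id_apply]
    ring

theorem kummerOp_apply (b m : ℂ) (w : ℂ⟦X⟧) : kummerOp b m w =
    X * d⁄dX ℂ (d⁄dX ℂ w) + C b * d⁄dX ℂ w - C (m / 2) * w - C (1 / 4) * (X * w) := rfl

theorem kummerOp_C_mul (b m c : ℂ) (w : ℂ⟦X⟧) :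
    kummerOp b m (C c * w) = C c * kummerOp b m w := by
  rw [← smul_eq_C_mul, map_smul, smul_eq_C_mul]

/-- A solution of the differential equation is determined by its constant coefficient. -/
theorem eq_zero_of_kummerOp_eq_zero {b m : ℂ} (hb : ∀ i : ℕ, b ≠ -(i : ℂ)) {w : ℂ⟦X⟧}
    (hw : kummerOp b m w = 0) (h0 : coeff 0 w = 0) : w = 0 := by
  have h2 : ∀ k : ℕ, b + k ≠ 0 := fun k h => hb k (eq_neg_of_add_eq_zero_left h)
  -- The equation gives a three-term recursion with leading factor (n+1)(b+n) ≠ 0, so the induction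
  -- carries two consecutive coefficients.
  have key : ∀ n, coeff n w = 0 ∧ coeff (n + 1) w = 0 := by
    intro n
    induction n with
    | zero =>
      refine ⟨h0, ?_⟩
      have h := congrArg (coeff 0) hw
      simp only [kummerOp_apply, map_add, map_sub, coeff_zero_X_mul, coeff_C_mul,
        coeff_derivative, h0, map_zero] at h
      have hb0 : b ≠ 0 := by simpa using hb 0
      simpa [hb0] using h
    | succ n ih =>
      refine ⟨ih.2, ?_⟩
      have h := congrArg (coeff (n + 1)) hw
      simp only [kummerOp_apply, map_add, map_sub, coeff_succ_X_mul, coeff_C_mul,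
        coeff_derivative, ih.1, ih.2, map_zero] at h
      have h3 : ((n : ℂ) + 1 + 1) ≠ 0 := by exact_mod_cast (n + 1).succ_ne_zero
      have h4 := h2 (n + 1)
      push_cast at h h4
      refine (mul_eq_zero.1 (?_ : ((n : ℂ) + 1 + 1) * (b + (n + 1)) * _ = 0)).resolve_left
        (mul_ne_zero h3 h4)
      linear_combination h
  ext n
  simpa using (key n).1

/-- Conjugating Kummer's equation by exp(-X/2) removes the term X w'; the constant that remains is a
- b/2 = m/2. -/
theorem kummerOp_expSeries_mul_kummerSeries (a b m : ℂ) (hb : ∀ i : ℕ, b ≠ -(i : ℂ))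
    (hm : b = 2 * a - m) :
    kummerOp b m (expSeries (-1 / 2) * kummerSeries a b) = 0 := by
  have hode := kummerSeries_ode a b hb
  have hE := derivative_expSeries (-1 / 2)
  have h4 : (C (1 / 4) : ℂ⟦X⟧) = C (-1 / 2) * C (-1 / 2) := by rw [← map_mul]; norm_num
  have h2 : (2 : ℂ⟦X⟧) * C (-1 / 2) = -1 := by
    rw [show (2 : ℂ⟦X⟧) = C 2 from (map_ofNat C 2).symm, ← map_mul]; norm_num
  have hM : (C (m / 2) : ℂ⟦X⟧) = C a + C (-1 / 2) * C b := by
    rw [← map_mul, ← map_add]; congr 1; rw [hm]; ring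
  rw [kummerOp_apply, h4, hM]
  simp only [Derivation.leibniz, smul_eq_mul, map_add, hE, derivative_C]
  linear_combination expSeries (-1 / 2) * hode +
    X * expSeries (-1 / 2) * d⁄dX ℂ (kummerSeries a b) * h2

/-- The terms `X ^ j ₀F₁[-; ν + j | X ^ 2 / 16]` of the expansion. -/
noncomputable def besselTerm (ν : ℂ) (j : ℕ) : ℂ⟦X⟧ := X ^ j * besselSeries (ν + j)

theorem kummerOp_besselTerm_zero (ν m : ℂ) (hν : ∀ i : ℕ, ν ≠ -(i : ℂ)) :
    kummerOp (2 * ν + m - 1) m (besselTerm ν 0) =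
      C (m / (8 * ν)) * besselTerm ν 1 - C (m / 2) * besselTerm ν 0 := by
  have hν1 : ∀ i : ℕ, ν + 1 ≠ -(i : ℂ) := fun i h => hν (1 + i) (by
    push_cast; linear_combination h)
  have h0 : ν ≠ 0 := by simpa using hν 0
  have h1 : ν + 1 ≠ 0 := by simpa using hν1 0
  have hd := derivative_besselSeries ν hν
  have hd1 := derivative_besselSeries (ν + 1) hν1
  have hc := besselSeries_contiguous ν hν
  rw [add_assoc ν 1 1, one_add_one_eq_two] at hd1
  have e1 : (C (1 / (8 * ν)) * C (1 / (8 * (ν + 1))) : ℂ⟦X⟧) =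
      C (1 / 4) * C (1 / (16 * ν * (ν + 1))) := by
    rw [← map_mul, ← map_mul]; congr 1; field_simp; norm_num
  have e2 : (C (2 * ν + m - 1) * C (1 / (8 * ν)) : ℂ⟦X⟧) =
      C (1 / 4) + C (m / (8 * ν)) - C (1 / (8 * ν)) := by
    rw [← map_mul, ← map_add, ← map_sub]; congr 1; field_simp; ring
  simp only [kummerOp_apply, besselTerm, pow_zero, one_mul, pow_one, Nat.cast_zero, add_zero,
    Nat.cast_one, hd, Derivation.leibniz, smul_eq_mul, derivative_C, derivative_X, hd1]
  linear_combination -C (1 / 4) * X * hc + X ^ 3 * besselSeries (ν + 2) * e1 +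
    X * besselSeries (ν + 1) * e2

/-- The difference in the last bracket equals X^j ₀F₁[-; ν + j + 1] by the contiguous relation, and
(j+1)(j+b), with b = 2ν + m - 1, is the indicial factor of X^{j+1}. Writing it through terms j and j
+ 2 prepares the telescoping. -/
theorem kummerOp_besselTerm_succ (ν m : ℂ) (hν : ∀ i : ℕ, ν ≠ -(i : ℂ)) (j : ℕ) :
    kummerOp (2 * ν + m - 1) m (besselTerm ν (j + 1)) =
      C (m / (8 * (ν + j + 1))) * besselTerm ν (j + 2) - C (m / 2) * besselTerm ν (j + 1) +
      C ((j + 1) * (j + (2 * ν + m - 1))) *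
        (besselTerm ν j - C (1 / (16 * (ν + j) * (ν + j + 1))) * besselTerm ν (j + 2)) := by
  have hνk : ∀ k i : ℕ, ν + k ≠ -(i : ℂ) := fun k i h => hν (k + i) (by
    push_cast; linear_combination h)
  -- μ is the parameter of the term being differentiated; its neighbours have parameters μ - 1 and μ
  -- + 1.
  obtain ⟨μ, hμ⟩ : ∃ μ, μ = ν + j + 1 := ⟨_, rfl⟩
  have hμ0 : ∀ i : ℕ, μ ≠ -(i : ℂ) := by
    intro i; have := hνk (j + 1) i; rwa [Nat.cast_add, ← add_assoc, Nat.cast_one, ← hμ] at this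
  have hμ1 : ∀ i : ℕ, μ + 1 ≠ -(i : ℂ) := fun i h => hμ0 (1 + i) (by
    push_cast; linear_combination h)
  have hμm : ∀ i : ℕ, μ - 1 ≠ -(i : ℂ) := by
    intro i; have := hνk j i; rwa [hμ, add_sub_cancel_right]
  have h0 : μ ≠ 0 := by simpa using hμ0 0
  have h1 : μ + 1 ≠ 0 := by simpa using hμ1 0
  have hm1 : μ - 1 ≠ 0 := by simpa using hμm 0
  have hd := derivative_besselSeries μ hμ0
  have hd1 := derivative_besselSeries (μ + 1) hμ1
  have hc := besselSeries_contiguous μ hμ0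
  have hcm := besselSeries_contiguous (μ - 1) hμm
  rw [sub_add_cancel, show μ - 1 + 2 = μ + 1 by ring] at hcm
  rw [add_assoc μ 1 1, one_add_one_eq_two] at hd1
  have e1 : (C (1 / (8 * μ)) * C (1 / (8 * (μ + 1))) : ℂ⟦X⟧) =
      C (1 / 4) * C (1 / (16 * μ * (μ + 1))) := by
    rw [← map_mul, ← map_mul]; congr 1; field_simp; norm_num
  have hb : 2 * ν + m - 1 = 2 * μ - 2 * (j : ℂ) + m - 3 := by rw [hμ]; ring
  have e2 : ((C (2 * μ - 2 * (j : ℂ) + m - 3) + 2 * ((j : ℂ⟦X⟧) + 1) + 1) * C (1 / (8 * μ)) : ℂ⟦X⟧) =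
      C (1 / 4) + C (m / (8 * μ)) := by
    rw [show C (2 * μ - 2 * (j : ℂ) + m - 3) + 2 * ((j : ℂ⟦X⟧) + 1) + 1 =
        C (2 * μ - 2 * (j : ℂ) + m - 3 + (2 * ((j : ℂ) + 1) + 1)) by
      rw [map_add, map_add, map_mul, map_add, map_one, map_natCast, map_ofNat, add_assoc], ← map_mul, ← map_add]
    congr 1; field_simp; ring
  have e3 : (C ((j + 1) * (j + (2 * μ - 2 * (j : ℂ) + m - 3))) : ℂ⟦X⟧) =
      (j + 1) * (j + C (2 * μ - 2 * (j : ℂ) + m - 3)) := by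
    rw [map_mul, map_add, map_add, map_one, map_natCast]
  have t0 : besselTerm ν j = X ^ j * besselSeries (μ - 1) := by
    rw [besselTerm, hμ, add_sub_cancel_right]
  have t1 : besselTerm ν (j + 1) = X ^ (j + 1) * besselSeries μ := by
    rw [besselTerm, hμ]; push_cast; rw [add_assoc]
  have t2 : besselTerm ν (j + 2) = X ^ (j + 2) * besselSeries (μ + 1) := by
    rw [besselTerm, hμ]; push_cast; congr 2; ring
  rw [t0, t1, t2, hb, ← hμ, show ν + j = μ - 1 by rw [hμ]; ring, e3, kummerOp_apply, hcm]
  -- Multiplying by X avoids the truncated exponent j - 1 at j = 0.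
  have hX : d⁄dX ℂ (X ^ j : ℂ⟦X⟧) * (X : ℂ⟦X⟧) = (j : ℂ⟦X⟧) * (X : ℂ⟦X⟧) ^ j := by
    cases j with
    | zero => simp
    | succ j => simp [Derivation.leibniz_pow]; ring
  have hX1 : d⁄dX ℂ (X ^ (j + 1) : ℂ⟦X⟧) = ((j : ℂ⟦X⟧) + 1) * (X : ℂ⟦X⟧) ^ j := by
    simp [Derivation.leibniz_pow]
  simp only [hX1, hd, hd1, Derivation.leibniz, smul_eq_mul, derivative_C, derivative_X,
    map_add, Derivation.map_natCast, Derivation.map_one_eq_zero]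
  linear_combination (-C (1 / 4) * X ^ (j + 2)) * hc + X ^ (j + 4) * besselSeries (μ + 2) * e1 +
    X ^ (j + 2) * besselSeries (μ + 1) * e2 + (j + 1) * besselSeries μ * hX

/-- The coefficients of the expansion of `exp (-X / 2) ₁F₁[α; 2α - m]`. -/
noncomputable def kummerCoeff (m : ℕ) (α : ℂ) (j : ℕ) : ℂ :=
  (-1) ^ j * poch (-m) j * poch (2 * α - 2 * m - 1) j /
    (poch (2 * α - m) j * poch (α - m - 1 / 2) j * 4 ^ j * j.factorial)

theorem kummerCoeff_zero (m : ℕ) (α : ℂ) : kummerCoeff m α 0 = 1 := by simp [kummerCoeff]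

theorem kummerCoeff_succ (m : ℕ) (α : ℂ) (j : ℕ) :
    kummerCoeff m α (j + 1) = kummerCoeff m α j *
      ((-1 * (-m + j) * (2 * α - 2 * m - 1 + j)) /
        ((2 * α - m + j) * (α - m - 1 / 2 + j) * 4 * (j + 1))) := by
  rw [kummerCoeff, kummerCoeff, div_mul_div_comm]
  simp only [poch_succ, pow_succ, Nat.factorial_succ]
  push_cast
  congr 1 <;> ring

theorem kummerCoeff_eq_zero (m : ℕ) (α : ℂ) : kummerCoeff m α (m + 1) = 0 := by
  rw [kummerCoeff, poch_neg_natCast]; simp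

/-- Telescoping: the operator sends each partial sum to a boundary expression proportional to the
next coefficient. At J = m that coefficient vanishes, so the full sum is an exact solution. -/
theorem kummerOp_sum_besselTerm (m : ℕ) (α : ℂ)
    (hα : ∀ i : ℕ, 2 * α - m ≠ -(i : ℂ)) (hα_half : ∀ i : ℕ, α - m + 1 / 2 ≠ -(i : ℂ))
    (hα_one : 1 ≤ m → α - m - 1 / 2 ≠ 0) (J : ℕ) :
    kummerOp (2 * α - m) m
        (∑ j ∈ range (J + 1), C (kummerCoeff m α j) * besselTerm (α - m + 1 / 2) j) =
      C ((J + 1) * (J + (2 * α - m)) * kummerCoeff m α (J + 1)) *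
        (C (1 / (4 * (α - m + 1 / 2 + J))) * besselTerm (α - m + 1 / 2) (J + 1) -
          besselTerm (α - m + 1 / 2) J) := by
  set ν := α - m + 1 / 2 with hν
  have hb : 2 * α - m = 2 * ν + m - 1 := by rw [hν]; ring
  have hν0 : ∀ k : ℕ, ν + k ≠ 0 := fun k h => hα_half k (eq_neg_of_add_eq_zero_left h)
  have hb0 : ∀ k : ℕ, 2 * α - m + k ≠ 0 := fun k h => hα k (eq_neg_of_add_eq_zero_left h)
  induction J with
  | zero =>
    have h0 := hν0 0
    -- The factor 2α - 2m - 1 = 2(α - m - 1/2) cancels, which needs `hα_one`; for m = 0 the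
    -- coefficient is zero anyway. All later denominators α - m - 1/2 + j, j ≥ 1, are covered by
    -- `hα_half`.
    have hc : (0 + 1) * (0 + (2 * α - m)) * kummerCoeff m α 1 = (m : ℂ) / 2 := by
      have h1 := kummerCoeff_succ m α 0
      rw [zero_add] at h1
      rw [h1, kummerCoeff_zero]
      rcases Nat.eq_zero_or_pos m with rfl | hm
      · simp
      · have h1 := hα_one hm
        have h2 := hb0 0
        have h3 : 2 * α - 2 * m - 1 ≠ 0 := fun h => h1 (by linear_combination h / 2)
        push_cast
        rw [show α - m - 1 / 2 + (0 : ℂ) = (2 * α - 2 * m - 1) / 2 by ring]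
        push_cast at h2
        simp only [add_zero, zero_add] at h2 ⊢
        generalize 2 * α - 2 * (m : ℂ) - 1 = γ at h3 ⊢
        generalize 2 * α - (m : ℂ) = δ at h2 ⊢
        field_simp
        ring
    simp only [zero_add, Finset.sum_range_one, kummerCoeff_zero, map_one, one_mul, Nat.cast_zero]
      at hc ⊢
    rw [hb, kummerOp_besselTerm_zero ν m hα_half, ← hb, hc]
    have : (C ((m : ℂ) / (8 * ν)) : ℂ⟦X⟧) = C ((m : ℂ) / 2) * C (1 / (4 * (ν + 0))) := by
      rw [← map_mul]; congr 1; push_cast at h0; rw [add_zero] at h0 ⊢; field_simp; ring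
    rw [this]; ring
  | succ J ih =>
    rw [Finset.sum_range_succ, map_add, ih, kummerOp_C_mul]
    rw [hb, kummerOp_besselTerm_succ ν m hα_half, ← hb]
    have h0 := hν0 J
    have h1 := hν0 (J + 1)
    have h2 := hb0 (J + 1)
    have h3 : ((J : ℂ) + 1 + 1) ≠ 0 := by exact_mod_cast (J + 1).succ_ne_zero
    set c := kummerCoeff m α (J + 1)
    have hrec : 4 * (ν + J) * ((J + 2) * (J + 1 + (2 * α - m)) * kummerCoeff m α (J + 1 + 1)) =
        (m - J - 1) * (2 * ν - 1 + J) * c := by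
      rw [kummerCoeff_succ]
      push_cast at h2 ⊢
      rw [show α - m - 1 / 2 + ((J : ℂ) + 1) = ν + J by rw [hν]; ring]
      rw [show ((J : ℂ) + 2) = J + 1 + 1 by ring]
      rw [show (J : ℂ) + 1 + (2 * α - m) = 2 * α - m + (J + 1) by ring]
      field_simp
      rw [hν]; ring
    set h := (J + 2) * (J + 1 + (2 * α - m)) * kummerCoeff m α (J + 1 + 1) with hh
    have hh' : ((J + 1 : ℕ) + 1) * ((J + 1 : ℕ) + (2 * α - m)) * kummerCoeff m α (J + 1 + 1) = h := by
      rw [hh]; push_cast; ring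
    have hrec' : h = (m - J - 1) * (2 * ν - 1 + J) * c / (4 * (ν + J)) := by
      rw [eq_div_iff (by simpa using h0)]; linear_combination hrec
    rw [hh']
    push_cast at h1 ⊢
    rw [← add_assoc] at h1 ⊢
    -- `c1` and `c2` match the coefficients of the terms J + 1 and J + 2; the recursion for h yields
    -- both. The terms of index J cancel, by `c3`.
    have c1 : (C ((J + 1) * (J + (2 * α - m)) * c) * C (1 / (4 * (ν + J))) : ℂ⟦X⟧) =
        C c * C ((m : ℂ) / 2) - C h := by
      rw [← map_mul, ← map_mul, ← map_sub]; congr 1; rw [hrec', hb]; field_simp; ring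
    have c2 : (C c * (C ((m : ℂ) / (8 * (ν + J + 1))) - C ((J + 1) * (J + (2 * α - m))) *
        C (1 / (16 * (ν + J) * (ν + J + 1)))) : ℂ⟦X⟧) = C h * C (1 / (4 * (ν + J + 1))) := by
      rw [← map_mul, ← map_mul, ← map_sub, ← map_mul]; congr 1; rw [hrec', hb]; field_simp; ring
    have c3 : (C ((J + 1) * (J + (2 * α - m)) * c) : ℂ⟦X⟧) =
      C ((J + 1) * (J + (2 * α - m))) * C c := map_mul _ _ _
    linear_combination besselTerm ν (J + 1) * c1 + besselTerm ν (J + 2) * c2 -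
      besselTerm ν J * c3

/-- The extension of Kummer's second transformation to `₁F₁[α; 2α - m]`. -/
theorem expSeries_mul_kummerSeries (m : ℕ) (α : ℂ)
    (hα : ∀ i : ℕ, 2 * α - m ≠ -(i : ℂ)) (hα_half : ∀ i : ℕ, α - m + 1 / 2 ≠ -(i : ℂ))
    (hα_one : 1 ≤ m → α - m - 1 / 2 ≠ 0) :
    expSeries (-1 / 2) * kummerSeries α (2 * α - m) =
      ∑ j ∈ range (m + 1),
        C (kummerCoeff m α j) * (X ^ j * besselSeries (α + j - m + 1 / 2)) := by
  have hs : ∀ j : ℕ, X ^ j * besselSeries (α + j - m + 1 / 2) = besselTerm (α - m + 1 / 2) j := by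
    intro j; rw [besselTerm]; congr 2; ring
  simp only [hs]
  rw [← sub_eq_zero]
  refine eq_zero_of_kummerOp_eq_zero (m := m) hα ?_ ?_
  · rw [map_sub, kummerOp_expSeries_mul_kummerSeries _ _ _ hα rfl,
      kummerOp_sum_besselTerm m α hα hα_half hα_one, kummerCoeff_eq_zero]
    simp
  · rw [map_sub, map_sum, Finset.sum_eq_single 0]
    · have h := coeff_expSeries (-1 / 2) 0
      rw [coeff_zero_eq_constantCoeff] at h
      simp [h, kummerSeries, besselTerm, besselSeries, kummerCoeff_zero, besselAux]
    · intro j _ hj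
      simp [besselTerm, hj]
    · simp

/-! ### Products of two expansions. -/

/-- The coefficients of the product of `₀F₁[-; a | X / 16]` and `₀F₁[-; b | X / 16]`, where
`g = a + b - 1`. -/
noncomputable def baileyCoeff (a b g : ℂ) (q : ℕ) : ℂ :=
  poch (g / 2) q * poch ((g + 1) / 2) q / (poch a q * poch b q * poch g q * 4 ^ q * q.factorial)

theorem besselSeries_mul (a b g : ℂ) (ha : ∀ i : ℕ, a ≠ -(i : ℂ)) (hb : ∀ i : ℕ, b ≠ -(i : ℂ))
    (hg : ∀ i : ℕ, g ≠ -(i : ℂ)) (h : g = a + b - 1) :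
    besselSeries a * besselSeries b =
      expand 2 two_ne_zero (PowerSeries.mk (baileyCoeff a b g)) := by
  subst h
  rw [besselSeries, besselSeries, ← map_mul, besselAux_mul a b ha hb hg]
  rfl

/-- The expansion of the product of two series `₁F₁[α; 2α - m]`. -/
theorem expSeries_mul_kummerSeries_mul_kummerSeries (m n : ℕ) (α β : ℂ)
    (hα : ∀ i : ℕ, 2 * α - m ≠ -(i : ℂ)) (hβ : ∀ i : ℕ, 2 * β - n ≠ -(i : ℂ))
    (hα_half : ∀ i : ℕ, α - m + 1 / 2 ≠ -(i : ℂ)) (hβ_half : ∀ i : ℕ, β - n + 1 / 2 ≠ -(i : ℂ))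
    (hα_one : 1 ≤ m → α - m - 1 / 2 ≠ 0) (hβ_one : 1 ≤ n → β - n - 1 / 2 ≠ 0)
    (hαβ : ∀ i : ℕ, α + β - m - n ≠ -(i : ℂ)) :
    expSeries (-1) * (kummerSeries α (2 * α - m) * kummerSeries β (2 * β - n)) =
      ∑ j ∈ range (m + 1), ∑ k ∈ range (n + 1),
        C (kummerCoeff m α j * kummerCoeff n β k) * (X ^ (j + k) *
          expand 2 two_ne_zero (PowerSeries.mk (baileyCoeff (α + j - m + 1 / 2)
            (β + k - n + 1 / 2) (α + β + j + k - m - n)))) := by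
  have h1 : expSeries (-1) = expSeries (-1 / 2) * expSeries (-1 / 2) := by
    rw [← expSeries_add]; norm_num
  rw [h1, mul_mul_mul_comm, expSeries_mul_kummerSeries m α hα hα_half hα_one,
    expSeries_mul_kummerSeries n β hβ hβ_half hβ_one, Finset.sum_mul_sum]
  refine Finset.sum_congr rfl fun j _ => Finset.sum_congr rfl fun k _ => ?_
  rw [← besselSeries_mul _ _ _ _ _ _ (by ring), map_mul, pow_add]
  · ring
  · exact fun i h => hα_half (j + i) (by push_cast; linear_combination h)
  · exact fun i h => hβ_half (k + i) (by push_cast; linear_combination h)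
  · exact fun i h => hαβ (j + k + i) (by push_cast; linear_combination h)

/-! ### Growth of coefficients and absolute convergence -/

/-- The sequence `c n` grows at most like `ρ ^ n * n!`. -/
def FactorialBound (c : ℕ → ℂ) (ρ : ℝ) : Prop :=
  ∃ K : ℝ, ∀ n, ‖c n‖ ≤ K * (ρ ^ n * n.factorial)

/-- The coefficients of `F` are bounded by those of a multiple of `exp (σ X)`. -/
def ExpBound (F : ℂ⟦X⟧) (σ : ℝ) : Prop :=
  ∃ K : ℝ, ∀ n, ‖coeff n F‖ ≤ K * (σ ^ n / n.factorial)

theorem sum_antidiagonal_pow_div_factorial (σ τ : ℝ) (n : ℕ) :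
    ∑ i ∈ antidiagonal n, σ ^ i.1 / i.1.factorial * (τ ^ i.2 / i.2.factorial) =
      (σ + τ) ^ n / n.factorial := by
  rw [(Commute.all σ τ).add_pow', Finset.sum_div]
  refine Finset.sum_congr rfl fun i hi => ?_
  rw [HasAntidiagonal.mem_antidiagonal] at hi
  subst hi
  have h := Nat.add_choose_mul_factorial_mul_factorial i.2 i.1
  rw [add_comm i.2] at h
  have h1 : (i.1.factorial : ℝ) ≠ 0 := by exact_mod_cast i.1.factorial_ne_zero
  have h2 : (i.2.factorial : ℝ) ≠ 0 := by exact_mod_cast i.2.factorial_ne_zero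
  have h3 : ((i.1 + i.2).factorial : ℝ) ≠ 0 := by exact_mod_cast (i.1 + i.2).factorial_ne_zero
  have h' : (((i.1 + i.2).choose i.1 * i.2.factorial * i.1.factorial : ℕ) : ℝ)
    = (i.1 + i.2).factorial := by rw [h]
  push_cast at h'
  rw [nsmul_eq_mul]
  field_simp
  rw [← h']
  ring

theorem ExpBound.mul {F G : ℂ⟦X⟧} {σ τ : ℝ} (hF : ExpBound F σ) (hG : ExpBound G τ) :
    ExpBound (F * G) (σ + τ) := by
  obtain ⟨K, hK⟩ := hF
  obtain ⟨L, hL⟩ := hG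
  refine ⟨K * L, fun n => ?_⟩
  rw [coeff_mul, ← sum_antidiagonal_pow_div_factorial, Finset.mul_sum]
  refine norm_sum_le_of_le _ fun i _ => ?_
  rw [norm_mul, mul_mul_mul_comm]
  have : 0 ≤ K * (σ ^ i.1 / i.1.factorial) := (norm_nonneg _).trans (hK i.1)
  exact mul_le_mul (hK _) (hL _) (norm_nonneg _) this

theorem summable_prod_of_bounds {c : ℕ → ℂ} {F G : ℂ⟦X⟧} {ρ σ τ : ℝ} (hρ : 0 ≤ ρ) (hσ : 0 ≤ σ)
    (hτ : 0 ≤ τ) (hc : FactorialBound c ρ) (hF : ExpBound F σ) (hG : ExpBound G τ)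
    (h : ρ * (σ + τ) < 1) :
    Summable fun i : ℕ × ℕ => c (i.1 + i.2) * (coeff i.1 F * coeff i.2 G) := by
  obtain ⟨M, hM⟩ := hc
  obtain ⟨K, hK⟩ := hF
  obtain ⟨L, hL⟩ := hG
  have key : Summable fun i : ℕ × ℕ => (ρ ^ (i.1 + i.2) * (i.1 + i.2).factorial) *
      (σ ^ i.1 / i.1.factorial * (τ ^ i.2 / i.2.factorial)) := by
    -- Grouping the majorant along r + s = n, the binomial theorem collapses each diagonal to
    -- (ρ(σ+τ))^n.
    rw [← Finset.HasAntidiagonal.sigmaAntidiagonalEquivProd.summable_iff]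
    rw [summable_sigma_of_nonneg (fun i => by dsimp; positivity)]
    refine ⟨fun n => (hasSum_fintype _).summable, ?_⟩
    have e : ∀ n : ℕ, (∑' y : antidiagonal n, ((fun i : ℕ × ℕ =>
        (ρ ^ (i.1 + i.2) * (i.1 + i.2).factorial) *
        (σ ^ i.1 / i.1.factorial * (τ ^ i.2 / i.2.factorial))) ∘
        Finset.HasAntidiagonal.sigmaAntidiagonalEquivProd) ⟨n, y⟩) = (ρ * (σ + τ)) ^ n := by
      intro n
      rw [tsum_fintype]
      change ∑ y : antidiagonal n, (ρ ^ (y.1.1 + y.1.2) * (y.1.1 + y.1.2).factorial) *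
        (σ ^ y.1.1 / y.1.1.factorial * (τ ^ y.1.2 / y.1.2.factorial)) = _
      rw [Finset.sum_coe_sort (antidiagonal n) fun i => (ρ ^ (i.1 + i.2) * (i.1 + i.2).factorial) *
        (σ ^ i.1 / i.1.factorial * (τ ^ i.2 / i.2.factorial))]
      have : ∀ i ∈ antidiagonal n, (ρ ^ (i.1 + i.2) * (i.1 + i.2).factorial) *
          (σ ^ i.1 / i.1.factorial * (τ ^ i.2 / i.2.factorial)) =
          (ρ ^ n * n.factorial) * (σ ^ i.1 / i.1.factorial * (τ ^ i.2 / i.2.factorial)) := by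
        intro i hi
        rw [HasAntidiagonal.mem_antidiagonal] at hi
        rw [hi]
      rw [Finset.sum_congr rfl this, ← Finset.mul_sum, sum_antidiagonal_pow_div_factorial, mul_pow]
      have : (n.factorial : ℝ) ≠ 0 := by exact_mod_cast n.factorial_ne_zero
      field_simp
    simp only [e]
    exact summable_geometric_of_lt_one (by positivity) h
  refine Summable.of_norm_bounded (key.mul_left (M * (K * L))) fun i => ?_
  rw [norm_mul, norm_mul, mul_mul_mul_comm M, mul_mul_mul_comm K]
  have h1 : 0 ≤ K * (σ ^ i.1 / i.1.factorial) := (norm_nonneg _).trans (hK i.1)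
  have h2 : 0 ≤ M * (ρ ^ (i.1 + i.2) * (i.1 + i.2).factorial) := (norm_nonneg _).trans (hM _)
  exact mul_le_mul (hM _) (mul_le_mul (hK _) (hL _) (norm_nonneg _) h1) (by positivity) h2

/-- The passage from double series to the functional L_c on the Cauchy product. -/
theorem tsum_prod_eq_tsum_coeff_mul {c : ℕ → ℂ} {F G : ℂ⟦X⟧}
    (h : Summable fun i : ℕ × ℕ => c (i.1 + i.2) * (coeff i.1 F * coeff i.2 G)) :
    ∑' i : ℕ × ℕ, c (i.1 + i.2) * (coeff i.1 F * coeff i.2 G) =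
      ∑' n, c n * coeff n (F * G) := by
  rw [← Finset.HasAntidiagonal.sigmaAntidiagonalEquivProd.tsum_eq]
  refine ((Finset.HasAntidiagonal.sigmaAntidiagonalEquivProd.summable_iff.2 h).tsum_sigma'
    ?_).trans ?_
  rotate_left
  · refine tsum_congr fun n => ?_
    rw [tsum_fintype, coeff_mul, Finset.mul_sum]
    change ∑ y : antidiagonal n, c (y.1.1 + y.1.2) * (coeff y.1.1 F * coeff y.1.2 G) = _
    rw [Finset.sum_coe_sort (antidiagonal n) fun i => c (i.1 + i.2) * (coeff i.1 F * coeff i.2 G)]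
    refine Finset.sum_congr rfl fun i hi => ?_
    rw [HasAntidiagonal.mem_antidiagonal] at hi
    rw [hi]
  · exact fun n => (hasSum_fintype _).summable

theorem summable_of_bounds {c : ℕ → ℂ} {F : ℂ⟦X⟧} {ρ σ : ℝ} (hρ : 0 ≤ ρ) (hσ : 0 ≤ σ)
    (hc : FactorialBound c ρ) (hF : ExpBound F σ) (h : ρ * σ < 1) :
    Summable fun n => c n * coeff n F := by
  obtain ⟨M, hM⟩ := hc
  obtain ⟨K, hK⟩ := hF
  refine Summable.of_norm_bounded ((summable_geometric_of_lt_one (by positivity) h).mul_left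
    (M * K)) fun n => ?_
  have h2 : 0 ≤ M * (ρ ^ n * n.factorial) := (norm_nonneg _).trans (hM _)
  rw [norm_mul]
  refine (mul_le_mul (hM n) (hK n) (norm_nonneg _) h2).trans_eq ?_
  have : (n.factorial : ℝ) ≠ 0 := by exact_mod_cast n.factorial_ne_zero
  rw [mul_pow]
  field_simp

/-- Summability of the triple series, and its reduction to a double series. -/
theorem summable_triple_of_bounds {c : ℕ → ℂ} {E F G : ℂ⟦X⟧} {ρ υ σ τ : ℝ} (hρ : 0 ≤ ρ)
    (hυ : 0 ≤ υ) (hσ : 0 ≤ σ) (hτ : 0 ≤ τ) (hc : FactorialBound c ρ) (hE : ExpBound E υ)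
    (hF : ExpBound F σ) (hG : ExpBound G τ) (h : ρ * (υ + (σ + τ)) < 1) :
    Summable fun i : ℕ × ℕ × ℕ =>
      c (i.1 + (i.2.1 + i.2.2)) * (coeff i.1 E * (coeff i.2.1 F * coeff i.2.2 G)) := by
  obtain ⟨M, hM⟩ := hc
  obtain ⟨K, hK⟩ := hE
  obtain ⟨L, hL⟩ := hF
  obtain ⟨N, hN⟩ := hG
  have key : Summable fun i : ℕ × ℕ × ℕ =>
      (ρ ^ (i.1 + (i.2.1 + i.2.2)) * (i.1 + (i.2.1 + i.2.2)).factorial) *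
      (υ ^ i.1 / i.1.factorial *
        (σ ^ i.2.1 / i.2.1.factorial * (τ ^ i.2.2 / i.2.2.factorial))) := by
    let e : (ℕ × Σ n : ℕ, antidiagonal n) ≃ ℕ × ℕ × ℕ :=
      (Equiv.refl ℕ).prodCongr Finset.HasAntidiagonal.sigmaAntidiagonalEquivProd
    -- Only the last two indices are grouped by their sum; the fibres are finite and what remains is
    -- a double series of the kind already treated.
    let e' : (Σ p : ℕ × ℕ, antidiagonal p.2) ≃ (ℕ × Σ n : ℕ, antidiagonal n) :=
      { toFun := fun s => (s.1.1, ⟨s.1.2, s.2⟩)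
        invFun := fun s => ⟨(s.1, s.2.1), s.2.2⟩
        left_inv := fun _ => rfl
        right_inv := fun _ => rfl }
    rw [← (e'.trans e).summable_iff]
    rw [summable_sigma_of_nonneg (fun i => by dsimp; positivity)]
    refine ⟨fun n => (hasSum_fintype _).summable, ?_⟩
    have hsum : ∀ p : ℕ × ℕ, (∑' y : antidiagonal p.2, ((fun i : ℕ × ℕ × ℕ =>
        (ρ ^ (i.1 + (i.2.1 + i.2.2)) * (i.1 + (i.2.1 + i.2.2)).factorial) *
      (υ ^ i.1 / i.1.factorial *
        (σ ^ i.2.1 / i.2.1.factorial * (τ ^ i.2.2 / i.2.2.factorial)))) ∘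
        (e'.trans e)) ⟨p, y⟩) = (ρ ^ (p.1 + p.2) * (p.1 + p.2).factorial) *
          (υ ^ p.1 / p.1.factorial * ((σ + τ) ^ p.2 / p.2.factorial)) := by
      intro p
      rw [tsum_fintype]
      change ∑ y : antidiagonal p.2,
        (ρ ^ (p.1 + (y.1.1 + y.1.2)) * (p.1 + (y.1.1 + y.1.2)).factorial) *
          (υ ^ p.1 / p.1.factorial *
            (σ ^ y.1.1 / y.1.1.factorial * (τ ^ y.1.2 / y.1.2.factorial))) = _
      rw [Finset.sum_coe_sort (antidiagonal p.2) fun i =>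
        (ρ ^ (p.1 + (i.1 + i.2)) * (p.1 + (i.1 + i.2)).factorial) *
          (υ ^ p.1 / p.1.factorial * (σ ^ i.1 / i.1.factorial * (τ ^ i.2 / i.2.factorial)))]
      rw [← sum_antidiagonal_pow_div_factorial, Finset.mul_sum, Finset.mul_sum]
      refine Finset.sum_congr rfl fun i hi => ?_
      rw [HasAntidiagonal.mem_antidiagonal] at hi
      rw [hi]
    simp only [hsum]
    -- The double-series criterion is applied to the majorants themselves, cast to ℂ, with all
    -- constants 1.
    have h1 := summable_prod_of_bounds (c := fun n => ((ρ ^ n * n.factorial : ℝ) : ℂ))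
      (F := PowerSeries.mk fun n => ((υ ^ n / n.factorial : ℝ) : ℂ))
      (G := PowerSeries.mk fun n => (((σ + τ) ^ n / n.factorial : ℝ) : ℂ))
      hρ hυ (add_nonneg hσ hτ)
      ⟨1, fun n => by rw [Complex.norm_real, Real.norm_of_nonneg (by positivity), one_mul]⟩
      ⟨1, fun n => by
        rw [coeff_mk, Complex.norm_real, Real.norm_of_nonneg (by positivity), one_mul]⟩
      ⟨1, fun n => by
        rw [coeff_mk, Complex.norm_real, Real.norm_of_nonneg (by positivity), one_mul]⟩ h
    simp only [coeff_mk] at h1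
    exact_mod_cast h1
  refine Summable.of_norm_bounded (key.mul_left (M * (K * (L * N)))) fun i => ?_
  rw [norm_mul, norm_mul, norm_mul, mul_mul_mul_comm M, mul_mul_mul_comm K, mul_mul_mul_comm L]
  have h1 : 0 ≤ K * (υ ^ i.1 / i.1.factorial) := (norm_nonneg _).trans (hK i.1)
  have h2 : 0 ≤ M * (ρ ^ (i.1 + (i.2.1 + i.2.2)) * (i.1 + (i.2.1 + i.2.2)).factorial) :=
    (norm_nonneg _).trans (hM _)
  have h3 : 0 ≤ L * (σ ^ i.2.1 / i.2.1.factorial) := (norm_nonneg _).trans (hL _)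
  exact mul_le_mul (hM _) (mul_le_mul (hK _) (mul_le_mul (hL _) (hN _) (norm_nonneg _) h3)
    (by positivity) h1) (by positivity) h2

theorem tsum_triple_eq_tsum_coeff_mul {c : ℕ → ℂ} {E F G : ℂ⟦X⟧}
    (h : Summable fun i : ℕ × ℕ × ℕ =>
      c (i.1 + (i.2.1 + i.2.2)) * (coeff i.1 E * (coeff i.2.1 F * coeff i.2.2 G)))
    (h' : Summable fun i : ℕ × ℕ => c (i.1 + i.2) * (coeff i.1 E * coeff i.2 (F * G))) :
    ∑' i : ℕ × ℕ × ℕ, c (i.1 + (i.2.1 + i.2.2)) *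
        (coeff i.1 E * (coeff i.2.1 F * coeff i.2.2 G)) =
      ∑' n, c n * coeff n (E * (F * G)) := by
  rw [← tsum_prod_eq_tsum_coeff_mul h', h.tsum_prod, h'.tsum_prod]
  refine tsum_congr fun p => ?_
  have hp : Summable fun i : ℕ × ℕ =>
      (c (p + (i.1 + i.2)) * coeff p E) * (coeff i.1 F * coeff i.2 G) :=
    (h.prod_factor p).congr fun i => by ring
  have := tsum_prod_eq_tsum_coeff_mul (c := fun n => c (p + n) * coeff p E) hp
  simpa only [mul_assoc] using this

/-! ### The functional L_c under multiplication by X^J and under X ↦ X². -/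

theorem hasSum_X_pow_mul {c : ℕ → ℂ} {F : ℂ⟦X⟧} {J : ℕ} {s : ℂ}
    (h : HasSum (fun n => c (J + n) * coeff n F) s) :
    HasSum (fun n => c n * coeff n (X ^ J * F)) s := by
  have hinj : Function.Injective fun n : ℕ => J + n := add_right_injective J
  refine (hinj.hasSum_iff ?_).1 ?_
  · intro n hn
    rw [coeff_X_pow_mul', if_neg, mul_zero]
    exact fun hle => hn ⟨n - J, Nat.add_sub_cancel' hle⟩
  · refine h.congr_fun ?_
    intro n
    simp [add_comm J n, coeff_X_pow_mul]

theorem coeff_expand_two_mul (F : ℂ⟦X⟧) (q : ℕ) :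
    coeff (2 * q) (expand 2 two_ne_zero F) = coeff q F := by
  rw [coeff_expand_mul]

theorem coeff_expand_two_eq_zero (F : ℂ⟦X⟧) {n : ℕ} (h : n ∉ Set.range fun q : ℕ => 2 * q) :
    coeff n (expand 2 two_ne_zero F) = 0 :=
  coeff_expand_of_not_dvd _ _ _ fun ⟨q, hq⟩ => h ⟨q, hq.symm⟩

theorem hasSum_expand_two_iff {c : ℕ → ℂ} {F : ℂ⟦X⟧} {s : ℂ} :
    HasSum (fun q => c (2 * q) * coeff q F) s ↔
      HasSum (fun n => c n * coeff n (expand 2 two_ne_zero F)) s := by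
  have hinj : Function.Injective fun q : ℕ => 2 * q := mul_right_injective₀ two_ne_zero
  rw [← hinj.hasSum_iff (f := fun n => c n * coeff n (expand 2 two_ne_zero F))]
  · simp only [Function.comp_def, coeff_expand_two_mul]
  · intro n hn
    rw [coeff_expand_two_eq_zero F hn, mul_zero]

/-- Source of the weights [d : 1, 2]: the second factor is a series in X², so its index q counts
twice in the total degree. The skipped odd indices contribute zero. -/
theorem hasSum_prod_expand_two_iff {c : ℕ → ℂ} {E F : ℂ⟦X⟧} {s : ℂ} :
    HasSum (fun i : ℕ × ℕ => c (i.1 + 2 * i.2) * (coeff i.1 E * coeff i.2 F)) s ↔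
      HasSum (fun i : ℕ × ℕ =>
        c (i.1 + i.2) * (coeff i.1 E * coeff i.2 (expand 2 two_ne_zero F))) s := by
  have hinj : Function.Injective fun i : ℕ × ℕ => (i.1, 2 * i.2) := by
    rintro ⟨a, b⟩ ⟨a', b'⟩ h
    simpa using h
  rw [← hinj.hasSum_iff (f := fun i : ℕ × ℕ =>
    c (i.1 + i.2) * (coeff i.1 E * coeff i.2 (expand 2 two_ne_zero F)))]
  · simp only [Function.comp_def, coeff_expand_two_mul]
  · rintro ⟨p, n⟩ hn
    have : n ∉ Set.range fun q : ℕ => 2 * q := fun ⟨q, hq⟩ => hn ⟨(p, q), by simpa using hq⟩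
    simp only [coeff_expand_two_eq_zero F this, mul_zero]

/-! ### Growth of the coefficients that occur. -/

/-- A quotient of Pochhammer symbols grows slower than every geometric series. -/
theorem exists_norm_poch_div_poch_le (a b : ℂ) {ρ : ℝ}
    (hρ : 1 < ρ) : ∃ K : ℝ, 0 ≤ K ∧ ∀ n, ‖poch a n / poch b n‖ ≤ K * ρ ^ n := by
  have hρ0 : 0 < ρ := by linarith
  obtain ⟨r, hr1, hr2⟩ := exists_between hρ
  have hlim : Filter.Tendsto (fun n : ℕ => ‖(a + n) / (b + n)‖) Filter.atTop (nhds 1) := by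
    simpa using (tendsto_add_mul_div_add_mul_atTop_nhds a b 1 (one_ne_zero (α := ℂ))).norm
  -- Ratio test: consecutive quotients have ratio (a+n)/(b+n) → 1. If (b)_n vanishes, the quotient
  -- is 0 by convention and the ratio identity still holds, so b is unrestricted.
  have hs : Summable fun n => poch a n / poch b n / (ρ : ℂ) ^ n := by
    refine summable_of_ratio_norm_eventually_le (r := r / ρ) ((div_lt_one hρ0).2 hr2) ?_
    filter_upwards [hlim.eventually_le_const hr1] with n hn
    rw [poch_succ, poch_succ, pow_succ, mul_div_mul_comm, mul_div_mul_comm, norm_mul, mul_comm]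
    rw [norm_div _ (ρ : ℂ), Complex.norm_real, Real.norm_of_nonneg hρ0.le]
    gcongr
  obtain ⟨K, hK⟩ := (Metric.isBounded_range_of_tendsto _ hs.tendsto_atTop_zero).exists_norm_le
  refine ⟨K, (norm_nonneg _).trans (hK _ ⟨0, rfl⟩), fun n => ?_⟩
  have h := hK _ ⟨n, rfl⟩
  rw [norm_div _ ((ρ : ℂ) ^ n), norm_pow, Complex.norm_real, Real.norm_of_nonneg hρ0.le,
    div_le_iff₀ (by positivity)] at h
  exact h

theorem expBound_kummerSeries (a b : ℂ) {σ : ℝ}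
    (hσ : 1 < σ) : ExpBound (kummerSeries a b) σ := by
  obtain ⟨K, -, hK⟩ := exists_norm_poch_div_poch_le a b hσ
  refine ⟨K, fun n => ?_⟩
  rw [kummerSeries, coeff_mk, ← div_div, norm_div, Complex.norm_natCast, ← mul_div_assoc]
  gcongr
  exact hK n

theorem ExpBound.rescale_neg_one {F : ℂ⟦X⟧} {σ : ℝ} (h : ExpBound F σ) :
    ExpBound (rescale (-1) F) σ := by
  obtain ⟨K, hK⟩ := h
  exact ⟨K, fun n => by simpa [coeff_rescale] using hK n⟩

theorem expBound_expSeries_one {σ : ℝ} (hσ : 1 ≤ σ) : ExpBound (expSeries 1) σ := by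
  refine ⟨1, fun n => ?_⟩
  rw [coeff_expSeries, one_pow, norm_div, norm_one, Complex.norm_natCast, one_mul]
  gcongr
  exact one_le_pow₀ hσ

theorem expBound_expSeries_neg_one {σ : ℝ} (hσ : 1 ≤ σ) : ExpBound (expSeries (-1)) σ := by
  refine ⟨1, fun n => ?_⟩
  rw [coeff_expSeries, norm_div, norm_pow, norm_neg, norm_one, one_pow, Complex.norm_natCast,
    one_mul]
  gcongr
  exact one_le_pow₀ hσ

theorem expBound_expand_baileyCoeff {a b g : ℂ} (ha : ∀ i : ℕ, a ≠ -(i : ℂ))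
    (hb : ∀ i : ℕ, b ≠ -(i : ℂ)) (hg : ∀ i : ℕ, g ≠ -(i : ℂ)) {σ : ℝ} (hσ : 1 < σ) :
    ExpBound (expand 2 two_ne_zero (PowerSeries.mk (baileyCoeff a b g))) σ := by
  have hσ0 : 0 < σ := by linarith
  -- Three Pochhammer quotients cost τ^{3q}, while the coefficient sits in degree 2q, where σ^{2q}
  -- is allowed.
  obtain ⟨τ, hτ1, hτ2, hτ0⟩ : ∃ τ : ℝ, 1 < τ ∧ τ ^ 3 ≤ σ ^ 2 ∧ 0 ≤ τ := by
    have h2 : (σ ^ (2 / 3 : ℝ)) ^ 3 = σ ^ 2 := by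
      rw [← Real.rpow_natCast, ← Real.rpow_mul hσ0.le, ← Real.rpow_natCast σ 2]
      norm_num
    exact ⟨σ ^ (2 / 3 : ℝ), Real.one_lt_rpow hσ (by norm_num), h2.le, by positivity⟩
  obtain ⟨K₁, hK₁0, hK₁⟩ := exists_norm_poch_div_poch_le (g / 2) a hτ1
  obtain ⟨K₂, hK₂0, hK₂⟩ := exists_norm_poch_div_poch_le ((g + 1) / 2) b hτ1
  obtain ⟨K₃, hK₃0, hK₃⟩ := exists_norm_poch_div_poch_le 1 g hτ1
  refine ⟨K₁ * K₂ * K₃, fun n => ?_⟩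
  by_cases hn : n ∈ Set.range fun q : ℕ => 2 * q
  swap
  · rw [coeff_expand_two_eq_zero _ hn, norm_zero]
    positivity
  obtain ⟨q, rfl⟩ := hn
  dsimp only
  rw [coeff_expand_two_mul, coeff_mk]
  have hf : (q.factorial : ℂ) ≠ 0 := by exact_mod_cast q.factorial_ne_zero
  have hp1 := poch_ne_zero ha q
  have hp2 := poch_ne_zero hb q
  have hp3 := poch_ne_zero hg q
  have e : baileyCoeff a b g q = (poch (g / 2) q / poch a q) * (poch ((g + 1) / 2) q / poch b q) *
      (poch 1 q / poch g q) * (1 / (4 ^ q * q.factorial ^ 2)) := by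
    rw [baileyCoeff, poch_one]
    field_simp
  -- (2q)! is the central binomial coefficient times q!², and that coefficient is at most 4^q.
  have hfac : (1 : ℝ) / (4 ^ q * q.factorial ^ 2) ≤ 1 / (2 * q).factorial := by
    refine one_div_le_one_div_of_le (by positivity) ?_
    have h := Nat.centralBinom_le_four_pow q
    have h' := Nat.choose_mul_factorial_mul_factorial (show q ≤ 2 * q by omega)
    rw [show 2 * q - q = q by omega, ← Nat.centralBinom_eq_two_mul_choose] at h'
    rw [← h']
    push_cast
    rw [mul_assoc, ← sq]
    gcongr
    exact_mod_cast h
  rw [e, norm_mul, norm_mul, norm_mul]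
  have hn4 : ‖(1 : ℂ) / (4 ^ q * q.factorial ^ 2)‖ = 1 / (4 ^ q * q.factorial ^ 2) := by
    simp
  rw [hn4]
  calc _ ≤ (K₁ * τ ^ q) * (K₂ * τ ^ q) * (K₃ * τ ^ q) * (1 / (2 * q).factorial) := by
        gcongr
        · exact hK₁ q
        · exact hK₂ q
        · exact hK₃ q
    _ = K₁ * K₂ * K₃ * ((τ ^ 3) ^ q / (2 * q).factorial) := by ring
    _ ≤ K₁ * K₂ * K₃ * ((σ ^ 2) ^ q / (2 * q).factorial) := by gcongr
    _ = _ := by rw [pow_mul]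

/-- One summand of the equal-argument formulas, with E = exp(X): shifting by J replaces c by w c',
where w collects the prefactor and c' has the shifted parameters. -/
theorem summable_and_hasSum_of_prod_expand {c c' : ℕ → ℂ} {w : ℂ} {J : ℕ} {E F : ℂ⟦X⟧}
    {ρ σ τ : ℝ} (hρ : 0 ≤ ρ) (hσ : 0 ≤ σ) (hτ : 0 ≤ τ) (hw : ∀ M, c (J + M) = w * c' M)
    (hc : FactorialBound c' ρ) (hE : ExpBound E σ) (hF : ExpBound (expand 2 two_ne_zero F) τ)
    (h : ρ * (σ + τ) < 1) :
    (Summable fun i : ℕ × ℕ => c' (i.1 + 2 * i.2) * (coeff i.1 E * coeff i.2 F)) ∧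
      HasSum (fun n => c n * coeff n (X ^ J * (E * expand 2 two_ne_zero F)))
        (w * ∑' i : ℕ × ℕ, c' (i.1 + 2 * i.2) * (coeff i.1 E * coeff i.2 F)) := by
  have h1 := summable_prod_of_bounds hρ hσ hτ hc hE hF h
  have h2 := hasSum_prod_expand_two_iff.2 h1.hasSum
  refine ⟨h2.summable, hasSum_X_pow_mul ?_⟩
  simp only [hw, mul_assoc]
  refine HasSum.mul_left w ?_
  rw [h2.tsum_eq, tsum_prod_eq_tsum_coeff_mul h1]
  exact (summable_of_bounds hρ (add_nonneg hσ hτ) hc (hE.mul hF) h).hasSum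

theorem summable_and_hasSum_of_expand {c c' : ℕ → ℂ} {w : ℂ} {J : ℕ} {F : ℂ⟦X⟧}
    {ρ τ : ℝ} (hρ : 0 ≤ ρ) (hτ : 0 ≤ τ) (hw : ∀ M, c (J + M) = w * c' M)
    (hc : FactorialBound c' ρ) (hF : ExpBound (expand 2 two_ne_zero F) τ) (h : ρ * τ < 1) :
    (Summable fun q : ℕ => c' (2 * q) * coeff q F) ∧
      HasSum (fun n => c n * coeff n (X ^ J * expand 2 two_ne_zero F))
        (w * ∑' q : ℕ, c' (2 * q) * coeff q F) := by
  have h1 := summable_of_bounds hρ hτ hc hF h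
  have h2 := hasSum_expand_two_iff.2 h1.hasSum
  refine ⟨h2.summable, hasSum_X_pow_mul ?_⟩
  simp only [hw, mul_assoc]
  refine HasSum.mul_left w ?_
  rw [h2.tsum_eq]
  exact h1.hasSum

/-! ### The terms of the multiple hypergeometric series -/

/-- The factor of the terms of all the series which depends only on the total degree. -/
noncomputable def weight (d : ℂ) (es : List ℂ) (x : ℂ) (n : ℕ) : ℂ :=
  poch d n / pochProd es n * x ^ n

theorem pochProd_add (es : List ℂ) (j k M : ℕ) : pochProd es (j + k + M) =
    pochProd es (j + k) * pochProd (es.map fun e : ℂ => e + j + k) M := by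
  induction es with
  | nil => simp [pochProd]
  | cons e es ih =>
    simp only [pochProd, List.map_cons, List.prod_cons] at ih ⊢
    rw [ih, poch_add]
    push_cast
    rw [← add_assoc]
    ring

theorem weight_add (d : ℂ) (es : List ℂ) (x : ℂ) (j k M : ℕ) : weight d es x (j + k + M) =
    weight d es x (j + k) * weight (d + j + k) (es.map fun e : ℂ => e + j + k) x M := by
  rw [weight, weight, weight, pochProd_add, poch_add, pow_add, mul_div_mul_comm]
  push_cast
  rw [← add_assoc]
  ring

theorem kampeTerm_eq (d a b a' b' : ℂ) (es : List ℂ) (x : ℂ) :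
    kampeTerm [d] [a] [b] es [a'] [b'] x x = fun i => weight d es x (i.1 + i.2) *
      (coeff i.1 (kummerSeries a a') * coeff i.2 (kummerSeries b b')) := by
  funext i
  simp only [kampeTerm, weight, kummerSeries, coeff_mk, pow_add, pochProd, List.map_cons,
    List.map_nil, List.prod_singleton, div_eq_mul_inv, mul_inv]
  ring

theorem kampeTerm_neg_eq (d a b a' b' : ℂ) (es : List ℂ) (x : ℂ) :
    kampeTerm [d] [a] [b] es [a'] [b'] x (-x) = fun i => weight d es x (i.1 + i.2) *
      (coeff i.1 (kummerSeries a a') * coeff i.2 (rescale (-1) (kummerSeries b b'))) := by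
  funext i
  rw [coeff_rescale]
  simp only [kampeTerm, weight, kummerSeries, coeff_mk, pow_add, pochProd, List.map_cons,
    List.map_nil, List.prod_singleton, div_eq_mul_inv, mul_inv]
  rw [neg_pow x]
  ring

theorem tripleTerm_eq (d a b a' b' : ℂ) (es : List ℂ) (x : ℂ) :
    tripleTerm ⟨[d], [], [], [], [], [a], [b]⟩ ⟨es, [], [], [], [], [a'], [b']⟩ (-x) x x =
      fun i => weight d es x (i.1 + (i.2.1 + i.2.2)) * (coeff i.1 (expSeries (-1)) *
        (coeff i.2.1 (kummerSeries a a') * coeff i.2.2 (kummerSeries b b'))) := by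
  funext i
  rw [coeff_expSeries, ← add_assoc]
  simp only [tripleTerm, TripleParams.prod, weight, kummerSeries, coeff_mk, pow_add, pochProd,
    List.map_cons, List.map_nil, List.prod_singleton, List.prod_nil, div_eq_mul_inv, mul_inv]
  rw [neg_pow x]
  ring

theorem srivTerm_eq (d a b g : ℂ) (es : List ℂ) (x : ℂ) :
    srivTerm [(d, 1, 2)] [] [(g / 2, 1), ((g + 1) / 2, 1)] (es.map fun e : ℂ => (e, 1, 2)) []
      [(a, 1), (b, 1), (g, 1)] x (x ^ 2 / 4) = fun i => weight d es x (i.1 + 2 * i.2) *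
        (coeff i.1 (expSeries 1) * coeff i.2 (PowerSeries.mk (baileyCoeff a b g))) := by
  funext i
  rw [coeff_expSeries]
  simp only [srivTerm, jointProd, separateProd, weight, baileyCoeff, coeff_mk, pow_add, pochProd,
    List.map_cons, List.map_nil, List.prod_nil, List.prod_cons, one_mul,
    List.map_map, Function.comp_def, div_eq_mul_inv, mul_inv, mul_pow, pow_mul, inv_pow, one_pow]
  ring

/-- Duplication of (d)_{2q} and (e)_{2q} gives powers 4^q that cancel, so the argument stays x²/4.
Without e, the power from (d)_{2q} cancels the 4^q in `baileyCoeff`, and the argument becomes x². -/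
theorem hypTerm_eq (d e a b g x : ℂ) :
    hypTerm [g / 2, (g + 1) / 2, d / 2, (d + 1) / 2] [a, b, g, e / 2, (e + 1) / 2] (x ^ 2 / 4) =
      fun q => weight d [e] x (2 * q) * coeff q (PowerSeries.mk (baileyCoeff a b g)) := by
  funext q
  have h4 : (4 : ℂ) ^ q ≠ 0 := pow_ne_zero q (by norm_num)
  simp only [hypTerm, weight, baileyCoeff, coeff_mk, pochProd, poch_two_mul,
    List.map_cons, List.map_nil, List.prod_nil, List.prod_cons, pow_mul, mul_one, div_pow]
  field_simp

theorem hypTerm_eq' (d a b g x : ℂ) :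
    hypTerm [g / 2, (g + 1) / 2, d / 2, (d + 1) / 2] [a, b, g] (x ^ 2) =
      fun q => weight d [] x (2 * q) * coeff q (PowerSeries.mk (baileyCoeff a b g)) := by
  funext q
  have h4 : (4 : ℂ) ^ q ≠ 0 := pow_ne_zero q (by norm_num)
  simp only [hypTerm, weight, baileyCoeff, coeff_mk, pochProd, poch_two_mul,
    List.map_cons, List.map_nil, List.prod_nil, List.prod_cons, pow_mul, mul_one, div_one]
  field_simp

theorem factorialBound_weight_nil (d : ℂ) {x : ℂ} {ρ : ℝ} (h : ‖x‖ < ρ) :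
    FactorialBound (weight d [] x) ρ := by
  have hρ : 0 < ρ := (norm_nonneg x).trans_lt h
  -- The gap between |x| and ρ absorbs the subexponential growth of (d)_n / n!.
  obtain ⟨τ, hτ, hτρ⟩ : ∃ τ : ℝ, 1 < τ ∧ τ * ‖x‖ ≤ ρ := by
    rcases eq_or_ne x 0 with rfl | hx
    · exact ⟨2, by norm_num, by simpa using hρ.le⟩
    · have := norm_pos_iff.2 hx
      exact ⟨ρ / ‖x‖, (one_lt_div this).2 h, by field_simp; rfl⟩
  obtain ⟨K, hK0, hK⟩ := exists_norm_poch_div_poch_le d 1 hτ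
  refine ⟨K, fun n => ?_⟩
  have hn := hK n
  rw [poch_one, norm_div, Complex.norm_natCast, div_le_iff₀ (by positivity)] at hn
  simp only [weight, pochProd, List.map_nil, List.prod_nil, div_one, norm_mul, norm_pow]
  calc ‖poch d n‖ * ‖x‖ ^ n ≤ K * τ ^ n * n.factorial * ‖x‖ ^ n := by gcongr
    _ = K * ((τ * ‖x‖) ^ n * n.factorial) := by ring
    _ ≤ _ := by gcongr

theorem factorialBound_weight_singleton (d e x : ℂ) {ρ : ℝ} (hρ : 0 < ρ) :
    FactorialBound (weight d [e] x) ρ := by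
  obtain ⟨K, hK0, hK⟩ := exists_norm_poch_div_poch_le d e one_lt_two
  refine ⟨K * Real.exp (2 * ‖x‖ / ρ), fun n => ?_⟩
  -- (d)_n/(e)_n is O(2^n), and (2|x|)^n ≤ exp(2|x|/ρ) ρ^n n! for every ρ > 0: no restriction on x
  -- remains.
  have h := Real.pow_div_factorial_le_exp (2 * ‖x‖ / ρ) (by positivity) n
  rw [div_le_iff₀ (by positivity), div_pow, div_le_iff₀ (by positivity)] at h
  simp only [weight, pochProd, List.map_cons, List.map_nil, List.prod_singleton, norm_mul,
    norm_pow]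
  calc _ ≤ K * 2 ^ n * ‖x‖ ^ n := by gcongr; exact hK n
    _ = K * (2 * ‖x‖) ^ n := by ring
    _ ≤ K * (Real.exp (2 * ‖x‖ / ρ) * n.factorial * ρ ^ n) := by gcongr
    _ = _ := by ring

/-! ### The reduction formulas -/

section Reduction

variable {m n : ℕ} {d α β x : ℂ} {es : List ℂ} {ρ : ℝ}

/-- Taking `es` to be `[e]` or `[]` covers the formulas with and without e; they differ only in
which ρ the bound `hc` admits. -/
theorem kampe_same_sign_reduction
    (hα : ∀ i : ℕ, 2 * α - m ≠ -(i : ℂ)) (hβ : ∀ i : ℕ, 2 * β - n ≠ -(i : ℂ))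
    (hα_half : ∀ i : ℕ, α - m + 1 / 2 ≠ -(i : ℂ)) (hβ_half : ∀ i : ℕ, β - n + 1 / 2 ≠ -(i : ℂ))
    (hα_one : 1 ≤ m → α - m - 1 / 2 ≠ 0) (hβ_one : 1 ≤ n → β - n - 1 / 2 ≠ 0)
    (hαβ : ∀ i : ℕ, α + β - m - n ≠ -(i : ℂ)) (hρ : 0 < ρ) (hρ2 : 2 * ρ < 1)
    (hc : ∀ j k : ℕ, FactorialBound (weight (d + j + k) (es.map fun e : ℂ => e + j + k) x) ρ) :
    Summable (kampeTerm [d] [α] [β] es [2 * α - m] [2 * β - n] x x) ∧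
    (∀ j ∈ Finset.range (m + 1), ∀ k ∈ Finset.range (n + 1),
      Summable (srivTerm [(d + j + k, 1, 2)] []
        [((α + β + j + k - m - n) / 2, 1), ((α + β + j + k - m - n + 1) / 2, 1)]
        ((es.map fun e : ℂ => e + j + k).map fun e : ℂ => (e, 1, 2)) []
        [(α + j - m + 1 / 2, 1), (β + k - n + 1 / 2, 1), (α + β + j + k - m - n, 1)]
        x (x ^ 2 / 4))) ∧
    kampe [d] [α] [β] es [2 * α - m] [2 * β - n] x x =
      ∑ j ∈ Finset.range (m + 1), ∑ k ∈ Finset.range (n + 1),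
        weight d es x (j + k) * (kummerCoeff m α j * kummerCoeff n β k) *
        sriv [(d + j + k, 1, 2)] []
          [((α + β + j + k - m - n) / 2, 1), ((α + β + j + k - m - n + 1) / 2, 1)]
          ((es.map fun e : ℂ => e + j + k).map fun e : ℂ => (e, 1, 2)) []
          [(α + j - m + 1 / 2, 1), (β + k - n + 1 / 2, 1), (α + β + j + k - m - n, 1)]
          x (x ^ 2 / 4) := by
  -- Since 2ρ < 1 there is room for 1 < σ < 1/(2ρ): σ > 1 bounds every factor, and two factors still
  -- satisfy ρ(σ+σ) < 1.
  obtain ⟨σ, hσ1, hσ⟩ := exists_between ((one_lt_div (by positivity)).2 hρ2)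
  rw [lt_div_iff₀ (by positivity)] at hσ
  have hσ0 : 0 ≤ σ := by linarith
  have hσ2 : ρ * (σ + σ) < 1 := by linarith
  have hc0 : FactorialBound (weight d es x) ρ := by simpa using hc 0 0
  have hK := summable_prod_of_bounds hρ.le hσ0 hσ0 hc0
    (expBound_kummerSeries α (2 * α - m) hσ1) (expBound_kummerSeries β (2 * β - n) hσ1) hσ2
  have hS : ∀ j k : ℕ, _ := fun j k =>
    summable_and_hasSum_of_prod_expand (F := PowerSeries.mk (baileyCoeff (α + j - m + 1 / 2)
      (β + k - n + 1 / 2) (α + β + j + k - m - n))) hρ.le hσ0 hσ0 (weight_add d es x j k) (hc j k)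
      (expBound_expSeries_one hσ1.le) (expBound_expand_baileyCoeff
        (fun i h => hα_half (j + i) (by push_cast; linear_combination h))
        (fun i h => hβ_half (k + i) (by push_cast; linear_combination h))
        (fun i h => hαβ (j + k + i) (by push_cast; linear_combination h)) hσ1) hσ2
  have hid := expSeries_mul_kummerSeries_mul_kummerSeries m n α β hα hβ hα_half hβ_half hα_one
    hβ_one hαβ
  have hprod : kummerSeries α (2 * α - m) * kummerSeries β (2 * β - n) =
      expSeries 1 * (expSeries (-1) * (kummerSeries α (2 * α - m) * kummerSeries β (2 * β - n))) := by
    rw [← mul_assoc, ← expSeries_add, add_neg_cancel, expSeries_zero, one_mul]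
  rw [kampe, kampeTerm_eq]
  simp only [sriv, srivTerm_eq]
  refine ⟨hK, fun j _ k _ => (hS j k).1, ?_⟩
  rw [tsum_prod_eq_tsum_coeff_mul hK, hprod, hid]
  have hsum := hasSum_sum fun j (_ : j ∈ range (m + 1)) => hasSum_sum fun k
    (_ : k ∈ range (n + 1)) => (hS j k).2.mul_left (kummerCoeff m α j * kummerCoeff n β k)
  refine (hsum.congr_fun fun N => ?_).tsum_eq.trans ?_
  · simp only [Finset.mul_sum, map_sum]
    refine Finset.sum_congr rfl fun j _ => Finset.sum_congr rfl fun k _ => ?_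
    rw [mul_left_comm (expSeries 1), mul_left_comm (expSeries 1), coeff_C_mul]
    ring
  · refine Finset.sum_congr rfl fun j _ => Finset.sum_congr rfl fun k _ => ?_
    ring

theorem kampe_opposite_sign_reduction
    (hα : ∀ i : ℕ, 2 * α - m ≠ -(i : ℂ)) (hβ : ∀ i : ℕ, 2 * β - n ≠ -(i : ℂ))
    (hα_half : ∀ i : ℕ, α - m + 1 / 2 ≠ -(i : ℂ)) (hβ_half : ∀ i : ℕ, β - n + 1 / 2 ≠ -(i : ℂ))
    (hα_one : 1 ≤ m → α - m - 1 / 2 ≠ 0) (hβ_one : 1 ≤ n → β - n - 1 / 2 ≠ 0)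
    (hαβ : ∀ i : ℕ, α + β - m - n ≠ -(i : ℂ)) (hρ : 0 < ρ) (hρ2 : 2 * ρ < 1)
    (hc : ∀ j k : ℕ, FactorialBound (weight (d + j + k) (es.map fun e : ℂ => e + j + k) x) ρ) :
    Summable (kampeTerm [d] [α] [β - n] es [2 * α - m] [2 * β - n] x (-x)) ∧
    (∀ j k : ℕ, Summable fun q => weight (d + j + k) (es.map fun e : ℂ => e + j + k) x (2 * q) *
      coeff q (PowerSeries.mk (baileyCoeff (α + j - m + 1 / 2)
        (β + k - n + 1 / 2) (α + β + j + k - m - n)))) ∧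
    kampe [d] [α] [β - n] es [2 * α - m] [2 * β - n] x (-x) =
      ∑ j ∈ Finset.range (m + 1), ∑ k ∈ Finset.range (n + 1),
        weight d es x (j + k) * (kummerCoeff m α j * kummerCoeff n β k) *
        ∑' q, weight (d + j + k) (es.map fun e : ℂ => e + j + k) x (2 * q) *
          coeff q (PowerSeries.mk (baileyCoeff (α + j - m + 1 / 2)
            (β + k - n + 1 / 2) (α + β + j + k - m - n))) := by
  obtain ⟨σ, hσ1, hσ⟩ := exists_between ((one_lt_div (by positivity)).2 hρ2)
  rw [lt_div_iff₀ (by positivity)] at hσ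
  have hσ0 : 0 ≤ σ := by linarith
  have hσ2 : ρ * (σ + σ) < 1 := by linarith
  have hσ1' : ρ * σ < 1 := by nlinarith
  have hc0 : FactorialBound (weight d es x) ρ := by simpa using hc 0 0
  have hK := summable_prod_of_bounds hρ.le hσ0 hσ0 hc0
    (expBound_kummerSeries α (2 * α - m) hσ1)
    (expBound_kummerSeries (β - n) (2 * β - n) hσ1).rescale_neg_one hσ2
  have hS : ∀ j k : ℕ, _ := fun j k =>
    summable_and_hasSum_of_expand (F := PowerSeries.mk (baileyCoeff (α + j - m + 1 / 2)
      (β + k - n + 1 / 2) (α + β + j + k - m - n))) hρ.le hσ0 (weight_add d es x j k) (hc j k)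
      (expBound_expand_baileyCoeff
        (fun i h => hα_half (j + i) (by push_cast; linear_combination h))
        (fun i h => hβ_half (k + i) (by push_cast; linear_combination h))
        (fun i h => hαβ (j + k + i) (by push_cast; linear_combination h)) hσ1) hσ1'
  have hid := expSeries_mul_kummerSeries_mul_kummerSeries m n α β hα hβ hα_half hβ_half hα_one
    hβ_one hαβ
  have hneg := expSeries_neg_one_mul_kummerSeries β (2 * β - n) hβ
  rw [show 2 * β - n - β = β - n by ring] at hneg
  rw [kampe, kampeTerm_neg_eq]
  refine ⟨hK, fun j k => (hS j k).1, ?_⟩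
  -- Kummer's first transformation writes the second factor as exp(-X) G, so the product is exactly
  -- the expanded one and no exponential is left over.
  rw [tsum_prod_eq_tsum_coeff_mul hK, ← hneg, mul_left_comm, hid]
  have hsum := hasSum_sum fun j (_ : j ∈ range (m + 1)) => hasSum_sum fun k
    (_ : k ∈ range (n + 1)) => (hS j k).2.mul_left (kummerCoeff m α j * kummerCoeff n β k)
  refine (hsum.congr_fun fun N => ?_).tsum_eq.trans ?_
  · simp only [Finset.mul_sum, map_sum]
    refine Finset.sum_congr rfl fun j _ => Finset.sum_congr rfl fun k _ => ?_
    rw [coeff_C_mul]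
    ring
  · refine Finset.sum_congr rfl fun j _ => Finset.sum_congr rfl fun k _ => ?_
    ring

/-- Both sides are L_c of the same power series, once with exp(-X) absorbed into the second factor
and once with it kept apart. The third factor in the absolute bound is what requires 3ρ < 1. -/
theorem kampe_eq_triple (hβ : ∀ i : ℕ, 2 * β - n ≠ -(i : ℂ)) (hρ : 0 < ρ) (hρ3 : 3 * ρ < 1)
    (hc : FactorialBound (weight d es x) ρ) (a' : ℂ) :
    Summable (tripleTerm ⟨[d], [], [], [], [], [α], [β]⟩
        ⟨es, [], [], [], [], [a'], [2 * β - n]⟩ (-x) x x) ∧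
      kampe [d] [α] [β - n] es [a'] [2 * β - n] x (-x) =
        triple ⟨[d], [], [], [], [], [α], [β]⟩
          ⟨es, [], [], [], [], [a'], [2 * β - n]⟩ (-x) x x := by
  obtain ⟨σ, hσ1, hσ⟩ := exists_between ((one_lt_div (by positivity)).2 hρ3)
  rw [lt_div_iff₀ (by positivity)] at hσ
  have hσ0 : 0 ≤ σ := by linarith
  have hσ3 : ρ * (σ + (σ + σ)) < 1 := by linarith
  have hσ2 : ρ * (σ + σ) < 1 := by nlinarith
  have hF := expBound_kummerSeries α a' hσ1
  have hG := expBound_kummerSeries β (2 * β - n) hσ1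
  have hE := expBound_expSeries_neg_one hσ1.le
  have hK := summable_prod_of_bounds hρ.le hσ0 hσ0 hc hF
    (expBound_kummerSeries (β - n) (2 * β - n) hσ1).rescale_neg_one hσ2
  have hT := summable_triple_of_bounds hρ.le hσ0 hσ0 hσ0 hc hE hF hG hσ3
  have hT' := summable_prod_of_bounds hρ.le hσ0 (add_nonneg hσ0 hσ0) hc hE (hF.mul hG) hσ3
  have hneg := expSeries_neg_one_mul_kummerSeries β (2 * β - n) hβ
  rw [show 2 * β - n - β = β - n by ring] at hneg
  rw [kampe, triple, kampeTerm_neg_eq, tripleTerm_eq]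
  refine ⟨hT, ?_⟩
  rw [tsum_prod_eq_tsum_coeff_mul hK, tsum_triple_eq_tsum_coeff_mul hT hT', ← hneg, mul_left_comm]

end Reduction

/-! ### Assembly of the four formulas. -/

/-- P stands for (e)_{j+k}, or for 1 when e is absent. -/
theorem coefficient_eq (m n j k : ℕ) (d α β x P : ℂ) :
    poch d (j + k) * (-1) ^ (j + k) * poch (-m) j * poch (-n) k *
        poch (2 * α - 2 * m - 1) j * poch (2 * β - 2 * n - 1) k * x ^ (j + k) /
      (P * poch (2 * α - m) j * poch (2 * β - n) k *
        poch (α - m - 1 / 2) j * poch (β - n - 1 / 2) k *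
        2 ^ (2 * j + 2 * k) * (j.factorial : ℂ) * (k.factorial : ℂ)) =
      poch d (j + k) / P * x ^ (j + k) * (kummerCoeff m α j * kummerCoeff n β k) := by
  have h4 : (2 : ℂ) ^ (2 * j + 2 * k) = 4 ^ j * 4 ^ k := by
    rw [pow_add, pow_mul, pow_mul]; norm_num
  rw [h4, kummerCoeff, kummerCoeff, pow_add (-1 : ℂ)]
  simp only [div_eq_mul_inv, mul_inv]
  ring

theorem theorem2 (m n : ℕ) (d e α β : ℂ)
    (hd : 0 < d.re) (hde : d.re < e.re)
    -- no denominator parameter occurring in the formulas is degenerate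
    (hα : ∀ i : ℕ, 2 * α - m ≠ -(i : ℂ))
    (hβ : ∀ i : ℕ, 2 * β - n ≠ -(i : ℂ))
    (hα_half : ∀ i : ℕ, α - m + 1 / 2 ≠ -(i : ℂ))
    (hβ_half : ∀ i : ℕ, β - n + 1 / 2 ≠ -(i : ℂ))
    (hα_one : 1 ≤ m → α - m - 1 / 2 ≠ 0)
    (hβ_one : 1 ≤ n → β - n - 1 / 2 ≠ 0)
    (hαβ : ∀ i : ℕ, α + β - m - n ≠ -(i : ℂ)) :
    -- first formula
    (∀ x : ℂ,
        Summable (kampeTerm [d] [α] [β] [e] [2 * α - m] [2 * β - n] x x) ∧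
        (∀ j ∈ Finset.range (m + 1), ∀ k ∈ Finset.range (n + 1),
          Summable (srivTerm [(d + j + k, 1, 2)] []
              [((α + β + j + k - m - n) / 2, 1), ((α + β + j + k - m - n + 1) / 2, 1)]
              [(e + j + k, 1, 2)] []
              [(α + j - m + 1 / 2, 1), (β + k - n + 1 / 2, 1), (α + β + j + k - m - n, 1)]
              x (x ^ 2 / 4))) ∧
        kampe [d] [α] [β] [e] [2 * α - m] [2 * β - n] x x =
          ∑ j ∈ Finset.range (m + 1), ∑ k ∈ Finset.range (n + 1),
            poch d (j + k) * (-1) ^ (j + k) * poch (-m) j * poch (-n) k *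
              poch (2 * α - 2 * m - 1) j * poch (2 * β - 2 * n - 1) k * x ^ (j + k) /
            (poch e (j + k) * poch (2 * α - m) j * poch (2 * β - n) k *
              poch (α - m - 1 / 2) j * poch (β - n - 1 / 2) k *
              2 ^ (2 * j + 2 * k) * (j.factorial : ℂ) * (k.factorial : ℂ)) *
            sriv [(d + j + k, 1, 2)] []
              [((α + β + j + k - m - n) / 2, 1), ((α + β + j + k - m - n + 1) / 2, 1)]
              [(e + j + k, 1, 2)] []
              [(α + j - m + 1 / 2, 1), (β + k - n + 1 / 2, 1), (α + β + j + k - m - n, 1)]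
              x (x ^ 2 / 4)) ∧
    -- second formula
    (∀ x : ℂ,
        Summable (kampeTerm [d] [α] [β - n] [e] [2 * α - m] [2 * β - n] x (-x)) ∧
        Summable (tripleTerm ⟨[d], [], [], [], [], [α], [β]⟩
            ⟨[e], [], [], [], [], [2 * α - m], [2 * β - n]⟩ (-x) x x) ∧
        (∀ j ∈ Finset.range (m + 1), ∀ k ∈ Finset.range (n + 1),
          Summable (hypTerm [(α + β + j + k - m - n) / 2, (α + β + j + k - m - n + 1) / 2,
                (d + j + k) / 2, (d + j + k + 1) / 2]
              [α + j - m + 1 / 2, β + k - n + 1 / 2, α + β + j + k - m - n,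
                (e + j + k) / 2, (e + j + k + 1) / 2]
              (x ^ 2 / 4))) ∧
        kampe [d] [α] [β - n] [e] [2 * α - m] [2 * β - n] x (-x) =
          triple ⟨[d], [], [], [], [], [α], [β]⟩
            ⟨[e], [], [], [], [], [2 * α - m], [2 * β - n]⟩ (-x) x x ∧
        triple ⟨[d], [], [], [], [], [α], [β]⟩
            ⟨[e], [], [], [], [], [2 * α - m], [2 * β - n]⟩ (-x) x x =
          ∑ j ∈ Finset.range (m + 1), ∑ k ∈ Finset.range (n + 1),
            poch d (j + k) * (-1) ^ (j + k) * poch (-m) j * poch (-n) k *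
              poch (2 * α - 2 * m - 1) j * poch (2 * β - 2 * n - 1) k * x ^ (j + k) /
            (poch e (j + k) * poch (2 * α - m) j * poch (2 * β - n) k *
              poch (α - m - 1 / 2) j * poch (β - n - 1 / 2) k *
              2 ^ (2 * j + 2 * k) * (j.factorial : ℂ) * (k.factorial : ℂ)) *
            hyp [(α + β + j + k - m - n) / 2, (α + β + j + k - m - n + 1) / 2,
                (d + j + k) / 2, (d + j + k + 1) / 2]
              [α + j - m + 1 / 2, β + k - n + 1 / 2, α + β + j + k - m - n,
                (e + j + k) / 2, (e + j + k + 1) / 2]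
              (x ^ 2 / 4)) ∧
    -- third formula
    (∀ x : ℂ, ‖x‖ < 1 / 2 →
        Summable (kampeTerm [d] [α] [β] [] [2 * α - m] [2 * β - n] x x) ∧
        (∀ j ∈ Finset.range (m + 1), ∀ k ∈ Finset.range (n + 1),
          Summable (srivTerm [(d + j + k, 1, 2)] []
              [((α + β + j + k - m - n) / 2, 1), ((α + β + j + k - m - n + 1) / 2, 1)]
              [] []
              [(α + j - m + 1 / 2, 1), (β + k - n + 1 / 2, 1), (α + β + j + k - m - n, 1)]
              x (x ^ 2 / 4))) ∧
        kampe [d] [α] [β] [] [2 * α - m] [2 * β - n] x x =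
          ∑ j ∈ Finset.range (m + 1), ∑ k ∈ Finset.range (n + 1),
            poch d (j + k) * (-1) ^ (j + k) * poch (-m) j * poch (-n) k *
              poch (2 * α - 2 * m - 1) j * poch (2 * β - 2 * n - 1) k * x ^ (j + k) /
            (poch (2 * α - m) j * poch (2 * β - n) k *
              poch (α - m - 1 / 2) j * poch (β - n - 1 / 2) k *
              2 ^ (2 * j + 2 * k) * (j.factorial : ℂ) * (k.factorial : ℂ)) *
            sriv [(d + j + k, 1, 2)] []
              [((α + β + j + k - m - n) / 2, 1), ((α + β + j + k - m - n + 1) / 2, 1)]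
              [] []
              [(α + j - m + 1 / 2, 1), (β + k - n + 1 / 2, 1), (α + β + j + k - m - n, 1)]
              x (x ^ 2 / 4)) ∧
    -- fourth formula, in the domains of convergence of the double and of the triple series
    (∀ x : ℂ, ‖x‖ < 1 / 2 →
        Summable (kampeTerm [d] [α] [β - n] [] [2 * α - m] [2 * β - n] x (-x)) ∧
        (∀ j ∈ Finset.range (m + 1), ∀ k ∈ Finset.range (n + 1),
          Summable (hypTerm [(α + β + j + k - m - n) / 2, (α + β + j + k - m - n + 1) / 2,
                (d + j + k) / 2, (d + j + k + 1) / 2]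
              [α + j - m + 1 / 2, β + k - n + 1 / 2, α + β + j + k - m - n]
              (x ^ 2))) ∧
        kampe [d] [α] [β - n] [] [2 * α - m] [2 * β - n] x (-x) =
          ∑ j ∈ Finset.range (m + 1), ∑ k ∈ Finset.range (n + 1),
            poch d (j + k) * (-1) ^ (j + k) * poch (-m) j * poch (-n) k *
              poch (2 * α - 2 * m - 1) j * poch (2 * β - 2 * n - 1) k * x ^ (j + k) /
            (poch (2 * α - m) j * poch (2 * β - n) k *
              poch (α - m - 1 / 2) j * poch (β - n - 1 / 2) k *
              2 ^ (2 * j + 2 * k) * (j.factorial : ℂ) * (k.factorial : ℂ)) *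
            hyp [(α + β + j + k - m - n) / 2, (α + β + j + k - m - n + 1) / 2,
                (d + j + k) / 2, (d + j + k + 1) / 2]
              [α + j - m + 1 / 2, β + k - n + 1 / 2, α + β + j + k - m - n]
              (x ^ 2)) ∧
    (∀ x : ℂ, ‖x‖ < 1 / 3 →
        Summable (tripleTerm ⟨[d], [], [], [], [], [α], [β]⟩
            ⟨[], [], [], [], [], [2 * α - m], [2 * β - n]⟩ (-x) x x) ∧
        kampe [d] [α] [β - n] [] [2 * α - m] [2 * β - n] x (-x) =
          triple ⟨[d], [], [], [], [], [α], [β]⟩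
            ⟨[], [], [], [], [], [2 * α - m], [2 * β - n]⟩ (-x) x x) := by
  have hnil : ∀ x : ℂ, ∀ ρ : ℝ, ‖x‖ < ρ → ∀ j k : ℕ,
      FactorialBound (weight (d + j + k) (([] : List ℂ).map fun e : ℂ => e + j + k) x) ρ :=
    fun x ρ h j k => factorialBound_weight_nil _ h
  have hone : ∀ x : ℂ, ∀ ρ : ℝ, 0 < ρ → ∀ j k : ℕ,
      FactorialBound (weight (d + j + k) (([e] : List ℂ).map fun e : ℂ => e + j + k) x) ρ :=
    fun x ρ h j k => factorialBound_weight_singleton _ _ _ h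
  have hprod_one : ∀ N, pochProd [e] N = poch e N := fun N => by simp [pochProd]
  have hprod_nil : ∀ N, pochProd [] N = 1 := fun N => by simp [pochProd]
  have hcoef_one : ∀ (x : ℂ) (j k : ℕ), poch d (j + k) * (-1) ^ (j + k) * poch (-m) j * poch (-n) k *
        poch (2 * α - 2 * m - 1) j * poch (2 * β - 2 * n - 1) k * x ^ (j + k) /
      (poch e (j + k) * poch (2 * α - m) j * poch (2 * β - n) k *
        poch (α - m - 1 / 2) j * poch (β - n - 1 / 2) k *
        2 ^ (2 * j + 2 * k) * (j.factorial : ℂ) * (k.factorial : ℂ)) =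
      weight d [e] x (j + k) * (kummerCoeff m α j * kummerCoeff n β k) := by
    intro x j k
    rw [coefficient_eq, weight, hprod_one]
  have hcoef_nil : ∀ (x : ℂ) (j k : ℕ), poch d (j + k) * (-1) ^ (j + k) * poch (-m) j * poch (-n) k *
        poch (2 * α - 2 * m - 1) j * poch (2 * β - 2 * n - 1) k * x ^ (j + k) /
      (poch (2 * α - m) j * poch (2 * β - n) k *
        poch (α - m - 1 / 2) j * poch (β - n - 1 / 2) k *
        2 ^ (2 * j + 2 * k) * (j.factorial : ℂ) * (k.factorial : ℂ)) =
      weight d [] x (j + k) * (kummerCoeff m α j * kummerCoeff n β k) := by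
    intro x j k
    have h := coefficient_eq m n j k d α β x 1
    rw [one_mul] at h
    rw [h, weight, hprod_nil]
  refine ⟨fun x => ?_, fun x => ?_, fun x hx => ?_, fun x hx => ?_, fun x hx => ?_⟩
  · obtain ⟨h1, h2, h3⟩ := kampe_same_sign_reduction hα hβ hα_half hβ_half hα_one hβ_one hαβ
      -- With e present every ρ > 0 is admissible; 1/4 satisfies both 2ρ < 1 and 3ρ < 1.
      (ρ := 1 / 4) (by norm_num) (by norm_num) (hone x _ (by norm_num))
    refine ⟨h1, h2, h3.trans ?_⟩
    simp only [hcoef_one]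
    rfl
  · obtain ⟨h1, h2, h3⟩ := kampe_opposite_sign_reduction hα hβ hα_half hβ_half hα_one hβ_one hαβ
      (ρ := 1 / 4) (by norm_num) (by norm_num) (hone x _ (by norm_num))
    obtain ⟨h4, h5⟩ := kampe_eq_triple (d := d) (es := [e]) (x := x) (α := α) hβ (ρ := 1 / 4)
      (by norm_num) (by norm_num) (factorialBound_weight_singleton _ _ _ (by norm_num))
      (2 * α - m)
    refine ⟨h1, h4, fun j _ k _ => ?_, h5, h5.symm.trans (h3.trans ?_)⟩
    · rw [hypTerm_eq]
      exact h2 j k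
    · simp only [hcoef_one, hyp, hypTerm_eq]
      rfl
  · obtain ⟨ρ, hρ, hρ2⟩ := exists_between hx
    obtain ⟨h1, h2, h3⟩ := kampe_same_sign_reduction hα hβ hα_half hβ_half hα_one hβ_one hαβ
      ((norm_nonneg x).trans_lt hρ) (by linarith) (hnil x ρ hρ)
    refine ⟨h1, h2, h3.trans ?_⟩
    simp only [hcoef_nil]
    rfl
  · obtain ⟨ρ, hρ, hρ2⟩ := exists_between hx
    obtain ⟨h1, h2, h3⟩ := kampe_opposite_sign_reduction hα hβ hα_half hβ_half hα_one hβ_one hαβ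
      ((norm_nonneg x).trans_lt hρ) (by linarith) (hnil x ρ hρ)
    refine ⟨h1, fun j _ k _ => ?_, h3.trans ?_⟩
    · rw [hypTerm_eq']
      exact h2 j k
    · simp only [hcoef_nil, hyp, hypTerm_eq']
      rfl
  · obtain ⟨ρ, hρ, hρ3⟩ := exists_between hx
    exact kampe_eq_triple hβ ((norm_nonneg x).trans_lt hρ) (by linarith)
      (factorialBound_weight_nil _ hρ) _
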